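/- **Theorem (online multi-class learning implies private multi-class learning).** For all integers $K\ge 2$ and $d\ge 0$ there is a constant $C=C(K,d)>0$ such that the following holds. Let $\mathcal X$ be a measurable space and let $\mathcal H\subset[K]^{\mathcal X}$ have Littlestone dimension $\mathrm{Ldim}(\mathcal H)=d$; here $\mathrm{Ldim}(\mathcal H)$ is the largest depth of a complete binary tree whose internal nodes are labelled by points of $\mathcal X$, and the two edges below each node by two distinct labels in $[K]$, such that for every root-to-leaf path $(x_1,y_1),\dots,(x_m,y_m)$ some $h\in\mathcal H$ has $h(x_i)=y_i$ for all $i$. Let $\epsilon,\delta\in(0,1)$, let $\alpha,\beta\in(0,1/2)$, and let $n$ be any sample size with $$n\;\ge\; C\,\frac{\log(1/(\beta\delta))}{\alpha\epsilon}.$$ Then there is a randomized algorithm $\mathcal A:(\mathcal X\times[K])^n\to[K]^{\mathcal X}$ such that 1. $\mathcal A$ is $(\epsilon,\delta)$-differentially private: for all samples $S,S'$ that differ in exactly one example and all sets $T\subset[K]^{\mathcal X}$, $\ \mathbb P(\mathcal A(S)\in T)\le e^{\epsilon}\,\mathbb P(\mathcal A(S')\in T)+\delta$; 2. for every probability distribution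 $\mathcal D$ on $\mathcal X\times[K]$ that is realizable by $\mathcal H$ (some $h^\star\in\mathcal H$ has $\mathrm{loss}_{\mathcal D}(h^\star)=0$), with probability at least $1-\beta$ over $S\sim\mathcal D^n$ and the randomness of $\mathcal A$, the output $f=\mathcal A(S)$ satisfies $\mathrm{loss}_{\mathcal D}(f)\le\alpha$, where $\mathrm{loss}_{\mathcal D}(f)=\mathbb P_{(x,y)\sim\mathcal D}(f(x)\ne y)$. In particular $\mathcal H$ is $(\epsilon,\delta)$-DP PAC learnable in the realizable setting with sample complexity $n=O_{K,d}\big(\log(1/(\beta\delta))/(\alpha\epsilon)\big)$. *Measurability convention in 2:* $\mathcal H$ is pointwise separable up to a $\mathcal D$-null set of instances, i.e. on some measurable set $\mathcal X_0\subset\mathcal X$ of full measure all members of $\mathcal H$ are measurable and each is a pointwise limit of a sequence from one fixed countable subclass of $\mathcal H$. (This is automatic if $\mathcal X$ is countable with measurable points, if $\mathcal H$ is a countable class of measurable functions, and, points being measurable, for every $\mathcal D$ with countable support.) -/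

import Mathlib

open MeasureTheory Filter

/-- A complete binary mistake tree of depth `n`: every internal node carries an instance `x : X`, and
its two descending edges carry two distinct labels `y ≠ y'`. -/
inductive MistakeTree (X Y : Type*) : ℕ → Type _
  | leaf : MistakeTree X Y 0
  | node {n : ℕ} (x : X) (y y' : Y) (hne : y ≠ y') (l r : MistakeTree X Y n) :
      MistakeTree X Y (n + 1)

/-- The root-to-leaf paths of a mistake tree, as sequences of pairs (instance at the node, label of
the descending edge). -/
def MistakeTree.paths {X Y : Type*} : {n : ℕ} → MistakeTree X Y n → Set (List (X × Y))
  | _, .leaf => {[]}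
  | _, .node x y y' _ l r =>
      (fun p => (x, y) :: p) '' l.paths ∪ (fun p => (x, y') :: p) '' r.paths

/-- `T` is shattered by `H`: every root-to-leaf path is realized by some `h ∈ H`. -/
def MistakeTree.ShatteredBy {X Y : Type*} {n : ℕ} (T : MistakeTree X Y n) (H : Set (X → Y)) :
    Prop :=
  ∀ p ∈ T.paths, ∃ h ∈ H, ∀ z ∈ p, h z.1 = z.2

/-- The Littlestone dimension: the maximal depth of a mistake tree shattered by `H` (`⊤` if the
depths are unbounded). -/
noncomputable def Ldim {X Y : Type*} (H : Set (X → Y)) : ℕ∞ :=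
  ⨆ (n : ℕ) (_ : ∃ T : MistakeTree X Y n, T.ShatteredBy H), (n : ℕ∞)

/-- The population zero-one loss `E_{(x,y) ∼ D} 𝟙[f x ≠ y]`, as the `D`-measure of the error set
(the outer measure, should `f` not be measurable). -/
noncomputable def popLoss {X : Type*} [MeasurableSpace X] {K : ℕ} (D : Measure (X × Fin K))
    (f : X → Fin K) : ENNReal :=
  D {z | f z.1 ≠ z.2}

/-- `D` is realizable with respect to `H`. -/
def Realizable {X : Type*} [MeasurableSpace X] {K : ℕ} (H : Set (X → Fin K))
    (D : Measure (X × Fin K)) : Prop :=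
  ∃ h ∈ H, popLoss D h = 0

/-- A randomized learning algorithm on samples of size `n`: it maps a sample to a probability
distribution on hypotheses. The output distributions are discrete, so that every set of hypotheses
has a probability. -/
abbrev RandomizedLearner (X : Type*) (K n : ℕ) : Type _ :=
  (Fin n → X × Fin K) → PMF (X → Fin K)

/-- The samples `S` and `S'` differ in exactly one example. -/
def Neighboring {Z : Type*} {n : ℕ} (S S' : Fin n → Z) : Prop :=
  ∃ i, S i ≠ S' i ∧ ∀ j, j ≠ i → S j = S' j

/-- `(ε, δ)`-differential privacy, for all sets of outputs. -/
def IsDifferentiallyPrivate {X : Type*} {K n : ℕ} (ε δ : ℝ) (A : RandomizedLearner X K n) : Prop :=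
  ∀ S S' : Fin n → X × Fin K, Neighboring S S' → ∀ T : Set (X → Fin K),
    (A S).toOuterMeasure T ≤
      ENNReal.ofReal (Real.exp ε) * (A S').toOuterMeasure T + ENNReal.ofReal δ

/-- The probability, over `S ∼ Dⁿ` and the randomness of `A`, that the output hypothesis has
population loss at most `α`. (For a non-measurable integrand `∫⁻` is the lower integral, so a lower
bound on this quantity is then a bound on the inner probability.) -/
noncomputable def successProb {X : Type*} [MeasurableSpace X] {K n : ℕ}
    (A : RandomizedLearner X K n) (D : Measure (X × Fin K)) (α : ℝ) : ENNReal :=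
  ∫⁻ S, (A S).toOuterMeasure {f | popLoss D f ≤ ENNReal.ofReal α} ∂(Measure.pi fun _ : Fin n => D)

/-- The measurability convention (pointwise separability, up to a null set of instances): on a
measurable set `X₀` of instances of full measure, all members of `H` are measurable, and each is a
pointwise limit of a sequence from a fixed countable subclass `H₀`.
It holds for every `D` if `H` is a countable class of measurable functions or if `X` is countable
(with measurable points), and it holds for every class `H` if `D` has countable support (points
being measurable): take `X₀` countable. -/
def PointwiseSeparable {X : Type*} [MeasurableSpace X] {K : ℕ} (H : Set (X → Fin K))
    (D : Measure (X × Fin K)) : Prop :=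
  ∃ X₀ : Set X, MeasurableSet X₀ ∧ D {z | z.1 ∉ X₀} = 0 ∧
    (∀ h ∈ H, Measurable fun x : X₀ => h x) ∧
    ∃ H₀ ⊆ H, H₀.Countable ∧ ∀ h ∈ H, ∃ u : ℕ → X → Fin K,
      (∀ i, u i ∈ H₀) ∧ ∀ x ∈ X₀, ∀ᶠ i in atTop, u i x = h x

/-!
The learner lets many small blocks of examples vote for hypotheses and publishes a winner privately.

*Stability.* The standard optimal algorithm `soa` predicts, at each instance, the label that keeps the
Littlestone dimension of the version space largest, so each of its mistakes lowers that dimension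
(`not_shattersDepth_of_soa_ne`). Run it on two independent copies of the same random version space,
each refined by `m` fresh examples. Either the two predictors coincide with a probability bounded
below, and then some single predictor has a large probability; or they differ at some point, and
there, whatever the true label is, one of them is mistaken, so that guessing the label and the
mistaken copy lowers the dimension of the version space without losing the target
(`exists_atom_or_le_prod_ne`, `exists_advice_of_disagree`). The second case can occur at most `d`
times. As the guesses range over a finite set that depends on `K` and `d` only, some fixed sequence of
guesses makes the deterministic tournament learner output one hypothesis with probability at least
`η = η(K, d) > 0` (`exists_stable_hypothesis`).

*Voting.* Each block votes for the outputs of the tournament learner under all guesses, if consistent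
with the `m` fresh examples of the block. A hypothesis with `q` votes is output with probability
proportional to `exp (ε q / 3) - 1`, and the mechanism abstains with weight `L / δ`, where `L` bounds
the number of candidates of a ballot. As no weight goes to hypotheses without votes, this is a
probability distribution over any class, and it is private (`privateVote_le`). The stable hypothesis
gets many votes (`measure_voteCount_lt_le`). A hypothesis of loss above `α` is consistent with a given
block with probability at most `(1 - α) ^ m`, and given the block that nominates it the other blocks
are independent, so the expected total weight of such hypotheses is small, without any uniform
convergence over the class (`lintegral_bad_votes_le`). Taking `m` of order `1 / α`, with
`log (1 / (β δ)) / ε` blocks up to a factor, gives the sample size.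

*Measurability.* The learner depends on the instances only through the values of the hypotheses in
`H` at them, and it is run on the corresponding quotient of the instances. Under the separability
assumption the distribution lives on countably many measurable classes of this quotient
(`exists_countable_coding`): a countable class of finite Littlestone dimension distinguishes only
countably many instances (`countable_types_of_not_shattersDepth`), a form of the countability of types
in a stable theory. All probabilities are therefore computed on countable discrete spaces.
-/

/-! ### Mistake ranks and the standard optimal algorithm -/

/-- The class `V` shatters some mistake tree of depth `t`. -/
def ShattersDepth {X Y : Type*} (V : Set (X → Y)) (t : ℕ) : Prop :=
  ∃ T : MistakeTree X Y t, T.ShatteredBy V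

namespace ShattersDepth

variable {X Y : Type*} {V V' : Set (X → Y)} {t s : ℕ}

theorem mono (h : ShattersDepth V t) (hV : V ⊆ V') : ShattersDepth V' t := by
  obtain ⟨T, hT⟩ := h
  refine ⟨T, fun p hp => ?_⟩
  obtain ⟨f, hf, hfp⟩ := hT p hp
  exact ⟨f, hV hf, hfp⟩

theorem zero_iff : ShattersDepth V 0 ↔ V.Nonempty := by
  constructor
  · rintro ⟨T, hT⟩
    cases T
    obtain ⟨f, hf, -⟩ := hT [] rfl
    exact ⟨f, hf⟩
  · rintro ⟨f, hf⟩
    refine ⟨.leaf, fun p hp => ⟨f, hf, ?_⟩⟩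
    rw [show p = [] from hp]
    simp

theorem exists_node (h : ShattersDepth V (t + 1)) : ∃ x y y', y ≠ y' ∧
    ShattersDepth {h ∈ V | h x = y} t ∧ ShattersDepth {h ∈ V | h x = y'} t := by
  obtain ⟨T, hT⟩ := h
  cases T with
  | node x y y' hne l r =>
    refine ⟨x, y, y', hne, ⟨l, fun p hp => ?_⟩, ⟨r, fun p hp => ?_⟩⟩
    · obtain ⟨f, hf, hfp⟩ := hT ((x, y) :: p) (Or.inl ⟨p, hp, rfl⟩)
      exact ⟨f, ⟨hf, hfp (x, y) List.mem_cons_self⟩, fun z hz => hfp z (List.mem_cons_of_mem _ hz)⟩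
    · obtain ⟨f, hf, hfp⟩ := hT ((x, y') :: p) (Or.inr ⟨p, hp, rfl⟩)
      exact ⟨f, ⟨hf, hfp (x, y') List.mem_cons_self⟩, fun z hz => hfp z (List.mem_cons_of_mem _ hz)⟩

theorem of_succ (h : ShattersDepth V (t + 1)) : ShattersDepth V t := by
  obtain ⟨x, y, -, -, hl, -⟩ := h.exists_node
  exact hl.mono (Set.sep_subset _ _)

theorem anti (h : ShattersDepth V t) (hst : s ≤ t) : ShattersDepth V s := by
  induction hst with
  | refl => exact h
  | step _ ih => exact ih h.of_succ

theorem node (x : X) {y y' : Y} (hne : y ≠ y') (hl : ShattersDepth {h ∈ V | h x = y} t)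
    (hr : ShattersDepth {h ∈ V | h x = y'} t) : ShattersDepth V (t + 1) := by
  obtain ⟨l, hl⟩ := hl
  obtain ⟨r, hr⟩ := hr
  refine ⟨.node x y y' hne l r, ?_⟩
  rintro _ (⟨p, hp, rfl⟩ | ⟨p, hp, rfl⟩)
  · obtain ⟨f, hf, hfp⟩ := hl p hp
    exact ⟨f, hf.1, by simpa [hf.2] using hfp⟩
  · obtain ⟨f, hf, hfp⟩ := hr p hp
    exact ⟨f, hf.1, by simpa [hf.2] using hfp⟩

/-- Mistake trees lift along a surjection of the instances. -/
theorem comp_surjective {Q : Type*} {q : X → Q} (hq : Function.Surjective q) {V : Set (Q → Y)}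
    (h : ShattersDepth V t) : ShattersDepth ((fun g => g ∘ q) '' V) t := by
  induction t generalizing V with
  | zero => exact zero_iff.2 ((zero_iff.1 h).image _)
  | succ t ih =>
    obtain ⟨c, y, y', hne, hl, hr⟩ := h.exists_node
    obtain ⟨x, rfl⟩ := hq c
    refine node x hne ((ih hl).mono ?_) ((ih hr).mono ?_) <;>
    · rintro _ ⟨g, hg, rfl⟩
      exact ⟨⟨g, hg.1, rfl⟩, hg.2⟩

theorem finite_paths : ∀ {n : ℕ} (T : MistakeTree X Y n), T.paths.Finite
  | _, .leaf => Set.finite_singleton _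
  | _, .node _ _ _ _ l r => ((finite_paths l).image _).union ((finite_paths r).image _)

/-- Shattering a tree involves finitely many hypotheses only. -/
theorem exists_finite (h : ShattersDepth V t) :
    ∃ W ⊆ V, W.Finite ∧ ShattersDepth W t := by
  obtain ⟨T, hT⟩ := h
  choose g hg hgp using hT
  have : Finite T.paths := finite_paths T
  refine ⟨Set.range fun p : T.paths => g p p.2, ?_, Set.finite_range _, T,
    fun p hp => ⟨g p hp, ⟨⟨p, hp⟩, rfl⟩, hgp p hp⟩⟩
  rintro _ ⟨p, rfl⟩
  exact hg p p.2

end ShattersDepth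

theorem not_shattersDepth_of_ldim_eq {X Y : Type*} {H : Set (X → Y)} {d : ℕ}
    (h : Ldim H = (d : ℕ∞)) : ¬ ShattersDepth H (d + 1) := by
  intro hs
  have h1 : ((d + 1 : ℕ) : ℕ∞) ≤ Ldim H :=
    le_iSup₂_of_le (f := fun (n : ℕ) (_ : ∃ T : MistakeTree X Y n, T.ShatteredBy H) => (n : ℕ∞))
      (d + 1) hs le_rfl
  rw [h] at h1
  exact absurd (by exact_mod_cast h1) (Nat.not_succ_le_self d)

/-- The least depth of which `V` shatters no mistake tree: the Littlestone dimension plus one, but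
`0` for the empty class, and (a junk value) also `0` for a class of infinite Littlestone
dimension. -/
noncomputable def mistakeRank {X Y : Type*} (V : Set (X → Y)) : ℕ :=
  sInf {t | ¬ ShattersDepth V t}

section Rank

variable {X Y : Type*} {V V' : Set (X → Y)} {n t : ℕ}

theorem lt_mistakeRank_iff (hV : ¬ ShattersDepth V n) : t < mistakeRank V ↔ ShattersDepth V t := by
  constructor
  · intro h
    by_contra hs
    exact Nat.notMem_of_lt_sInf h hs
  · intro h
    by_contra hs
    have h1 : ¬ ShattersDepth V (mistakeRank V) :=
      Nat.sInf_mem (s := {t | ¬ ShattersDepth V t}) ⟨n, hV⟩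
    exact h1 (h.anti (not_lt.1 hs))

theorem mistakeRank_mono (hV : ¬ ShattersDepth V' n) (h : V ⊆ V') :
    mistakeRank V ≤ mistakeRank V' := by
  by_contra! hlt
  have h1 : ¬ ShattersDepth V n := fun hs => hV (hs.mono h)
  exact lt_irrefl _ ((lt_mistakeRank_iff hV).2 (((lt_mistakeRank_iff h1).1 hlt).mono h))

end Rank

/-- The prediction of the standard optimal algorithm with version space `V`: at `x`, a label whose
section of `V` has the largest mistake rank. -/
noncomputable def soa {X : Type*} {K : ℕ} [NeZero K] (V : Set (X → Fin K)) (x : X) : Fin K :=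
  (Finite.exists_max fun y => mistakeRank {h ∈ V | h x = y}).choose

section SOA

variable {X : Type*} {K : ℕ} [NeZero K] {V : Set (X → Fin K)} {r : ℕ} {x : X} {y : Fin K}

theorem mistakeRank_le_soa (V : Set (X → Fin K)) (x : X) (y : Fin K) :
    mistakeRank {h ∈ V | h x = y} ≤ mistakeRank {h ∈ V | h x = soa V x} :=
  (Finite.exists_max fun y => mistakeRank {h ∈ V | h x = y}).choose_spec y

theorem shattersDepth_soa (hV : ¬ ShattersDepth V r) {t : ℕ}
    (h : ShattersDepth {h ∈ V | h x = y} t) : ShattersDepth {h ∈ V | h x = soa V x} t := by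
  have hf (y : Fin K) : ¬ ShattersDepth {h ∈ V | h x = y} r :=
    fun hs => hV (hs.mono (Set.sep_subset _ _))
  exact (lt_mistakeRank_iff (hf _)).1
    (((lt_mistakeRank_iff (hf y)).2 h).trans_le (mistakeRank_le_soa V x y))

/-- Each mistake of the standard optimal algorithm lowers the Littlestone dimension. -/
theorem not_shattersDepth_of_soa_ne (hV : ¬ ShattersDepth V (r + 1)) (hy : soa V x ≠ y) :
    ¬ ShattersDepth {h ∈ V | h x = y} r :=
  fun hs => hV ((shattersDepth_soa hV hs).node x hy hs)

/-- The standard optimal algorithm predicts every label that its version space determines. -/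
theorem soa_eq_of_forall (hV : ¬ ShattersDepth V r) (hne : V.Nonempty) (h : ∀ f ∈ V, f x = y) :
    soa V x = y := by
  have h0 : ShattersDepth {h ∈ V | h x = y} 0 := by
    obtain ⟨f, hf⟩ := hne
    exact ShattersDepth.zero_iff.2 ⟨f, hf, h f hf⟩
  obtain ⟨f, hf, hfx⟩ := ShattersDepth.zero_iff.1 (shattersDepth_soa hV h0)
  rw [← hfx, h f hf]

end SOA

/-! ### Countably many instance types over a countable class -/

/-- A countable class of finite Littlestone dimension distinguishes only countably many instances.

Pick a countable `X₁ ⊆ X₀` realizing every finite pattern of values that occurs on `X₀`. If the values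
at some `x₀ ∈ X₀` were not determined by the values at finitely many points of `X₁`, then for some
labels `a ≠ b` there would be "unsettled" subclasses: finitely many points of `X₁` never suffice to
rule out `h x₀ = a`, `h' x₀ = b`. Among them take `V` with the smallest sum of the ranks of its parts
`h x₀ = a` and `h x₀ = b`, and a point `x ∈ X₁` that looks like `x₀` to the hypotheses shattering
optimal trees for the two parts. Some section `h x = y` of `V` is again unsettled, with the same ranks
by minimality; as `y ≠ a` or `y ≠ b`, the node `x` makes one of the two optimal trees deeper. -/
theorem countable_types_of_not_shattersDepth {X : Type*} {K n : ℕ} [NeZero K] {H : Set (X → Fin K)}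
    (hc : H.Countable) (hH : ¬ ShattersDepth H n) (X₀ : Set X) :
    ((fun (x : X) (h : H) => h.1 x) '' X₀).Countable := by
  classical
  have : Countable H := hc
  obtain ⟨X₁, hX₁c, hX₁⟩ : ∃ X₁ : Set X, X₁.Countable ∧
      ∀ x ∈ X₀, ∀ F : Set (X → Fin K), F ⊆ H → F.Finite → ∃ x₁ ∈ X₁, ∀ h ∈ F, h x₁ = h x := by
    let good (p : Σ F : Finset H, (F → Fin K)) (x : X) : Prop := ∀ h, h.1.1 x = p.2 h
    refine ⟨{x | ∃ p, ∃ hp : ∃ x, good p x, x = hp.choose}, ?_, ?_⟩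
    · have : {x | ∃ p, ∃ hp : ∃ x, good p x, x = hp.choose} ⊆
          Set.range (fun p : {p // ∃ x, good p x} => p.2.choose) := by
        rintro x ⟨p, hp, rfl⟩
        exact ⟨⟨p, hp⟩, rfl⟩
      exact (Set.countable_range _).mono this
    · intro x _ F hF hfin
      let F' : Finset H := (hfin.preimage (Subtype.val_injective.injOn)).toFinset
      let p : Σ F : Finset H, (F → Fin K) := ⟨F', fun h => h.1.1 x⟩
      have hp : ∃ x, good p x := ⟨x, fun h => rfl⟩
      refine ⟨hp.choose, ⟨p, hp, rfl⟩, fun h hh => ?_⟩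
      exact hp.choose_spec ⟨⟨h, hF hh⟩, by simpa [p, F'] using hh⟩
  have key : ∀ x₀ ∈ X₀, ∃ F : Finset X₁, ∀ h ∈ H, ∀ h' ∈ H, (∀ x ∈ F, h x = h' x) →
      h x₀ = h' x₀ := by
    intro x₀ hx₀
    by_contra! hcon
    let unsettled (a b : Fin K) (V : Set (X → Fin K)) : Prop := ∀ F : Finset X₁,
      ∃ h ∈ V, ∃ h' ∈ V, (∀ x ∈ F, h x = h' x) ∧ h x₀ = a ∧ h' x₀ = b
    obtain ⟨a, b, hab, hbad⟩ : ∃ a b, a ≠ b ∧ unsettled a b H := by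
      by_contra! hno
      have hno' : ∀ p : Fin K × Fin K, ∃ F : Finset X₁, p.1 ≠ p.2 →
          ¬ ∃ h ∈ H, ∃ h' ∈ H, (∀ x ∈ F, h x = h' x) ∧ h x₀ = p.1 ∧ h' x₀ = p.2 := by
        intro p
        by_cases hp : p.1 = p.2
        · exact ⟨∅, fun h => (h hp).elim⟩
        · obtain ⟨F, hF⟩ := not_forall.1 (hno p.1 p.2 hp)
          exact ⟨F, fun _ => hF⟩
      choose F hF using hno'
      obtain ⟨h, hh, h', hh', hag, hne⟩ := hcon (Finset.univ.biUnion F)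
      refine hF (h x₀, h' x₀) hne ⟨h, hh, h', hh', fun x hx => hag x ?_, rfl, rfl⟩
      exact Finset.mem_biUnion.2 ⟨_, Finset.mem_univ _, hx⟩
    have hsplit : ∀ V, unsettled a b V → ∀ x : X₁, ∃ y, unsettled a b {h ∈ V | h x = y} := by
      intro V hV x
      by_contra! hno
      choose F hF using fun y => not_forall.1 (hno y)
      obtain ⟨h, hh, h', hh', hag, hhs⟩ := hV (insert x (Finset.univ.biUnion F))
      refine hF (h x) ⟨h, ⟨hh, rfl⟩, h', ⟨hh', (hag x (Finset.mem_insert_self _ _)).symm⟩,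
        fun z hz => hag z ?_, hhs⟩
      exact Finset.mem_insert_of_mem (Finset.mem_biUnion.2 ⟨_, Finset.mem_univ _, hz⟩)
    let part (V : Set (X → Fin K)) (c : Fin K) : Set (X → Fin K) := {h ∈ V | h x₀ = c}
    obtain ⟨V, ⟨hVH, hVbad⟩, hmin⟩ := WellFounded.has_min
      (measure fun V => mistakeRank (part V a) + mistakeRank (part V b)).wf
      {V | V ⊆ H ∧ unsettled a b V} ⟨H, subset_rfl, hbad⟩
    have hfin : ∀ {W : Set (X → Fin K)}, W ⊆ H → ¬ ShattersDepth W n :=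
      fun hW hs => hH (hs.mono hW)
    have hpart : ∀ c, part V c ⊆ H := fun c => (Set.sep_subset _ _).trans hVH
    obtain ⟨h₁, hh₁, h₂, hh₂, -, e₁, e₂⟩ := hVbad ∅
    -- An optimal tree for each of the two parts, shattered by finitely many hypotheses.
    have hopt : ∀ c, (part V c).Nonempty → ∃ W ⊆ part V c, W.Finite ∧
        ShattersDepth W (mistakeRank (part V c) - 1) := by
      intro c hc
      have h0 : 0 < mistakeRank (part V c) :=
        (lt_mistakeRank_iff (hfin (hpart c))).2 (ShattersDepth.zero_iff.2 hc)
      exact ((lt_mistakeRank_iff (hfin (hpart c))).1 (by omega)).exists_finite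
    obtain ⟨Wa, hWa, hWaf, hWas⟩ := hopt a ⟨h₁, hh₁, e₁⟩
    obtain ⟨Wb, hWb, hWbf, hWbs⟩ := hopt b ⟨h₂, hh₂, e₂⟩
    obtain ⟨x, hx, hxW⟩ := hX₁ x₀ hx₀ (Wa ∪ Wb)
      (Set.union_subset (hWa.trans (hpart a)) (hWb.trans (hpart b))) (hWaf.union hWbf)
    obtain ⟨y, hy⟩ := hsplit V hVbad ⟨x, hx⟩
    have hle : ∀ c, mistakeRank (part {h ∈ V | h x = y} c) ≤ mistakeRank (part V c) := fun c =>
      mistakeRank_mono (hfin (hpart c)) fun h hh => ⟨hh.1.1, hh.2⟩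
    have hge := hmin {h ∈ V | h x = y} ⟨(Set.sep_subset _ _).trans hVH, hy⟩
    have hge' : mistakeRank (part V a) + mistakeRank (part V b) ≤
        mistakeRank (part {h ∈ V | h x = y} a) + mistakeRank (part {h ∈ V | h x = y} b) :=
      not_lt.1 hge
    -- If the label `c` of the part differs from `y`, the node `x` deepens the optimal tree.
    have hdeep : ∀ c W, W ⊆ part V c → (∀ h ∈ W, h x = h x₀) → (part V c).Nonempty →
        ShattersDepth W (mistakeRank (part V c) - 1) →
        mistakeRank (part {h ∈ V | h x = y} c) = mistakeRank (part V c) → y = c := by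
      intro c W hWV hWx hne hWs heq
      by_contra hyc
      have h0 : 0 < mistakeRank (part V c) :=
        (lt_mistakeRank_iff (hfin (hpart c))).2 (ShattersDepth.zero_iff.2 hne)
      have hsub : part {h ∈ V | h x = y} c ⊆ H := fun h hh => hVH hh.1.1
      have h1 : ShattersDepth (part {h ∈ V | h x = y} c) (mistakeRank (part V c) - 1) :=
        (lt_mistakeRank_iff (hfin hsub)).1 (by omega)
      have h2 : ShattersDepth (part V c) (mistakeRank (part V c) - 1 + 1) :=
        ShattersDepth.node x hyc (h1.mono fun h hh => ⟨⟨hh.1.1, hh.2⟩, hh.1.2⟩)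
          (hWs.mono fun h hh => ⟨hWV hh, (hWx h hh).trans (hWV hh).2⟩)
      have h3 := (lt_mistakeRank_iff (hfin (hpart c))).2 h2
      omega
    have ha := hdeep a Wa hWa (fun h hh => hxW h (Or.inl hh)) ⟨h₁, hh₁, e₁⟩ hWas
      (by have := hle a; have := hle b; omega)
    have hb := hdeep b Wb hWb (fun h hh => hxW h (Or.inr hh)) ⟨h₂, hh₂, e₂⟩ hWbs
      (by have := hle a; have := hle b; omega)
    exact hab (ha.symm.trans hb)
  have : Countable X₁ := hX₁c
  refine (Set.countable_range fun (p : Σ F : Finset X₁, ((F → Fin K) → Fin K)) (h : H) =>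
    p.2 fun x => h.1 x.1).mono ?_
  rintro _ ⟨x₀, hx₀, rfl⟩
  obtain ⟨F, hF⟩ := key x₀ hx₀
  refine ⟨⟨F, Function.extend (fun (h : H) (x : F) => h.1 x.1) (fun h => h.1 x₀) 0⟩, ?_⟩
  funext h
  have hfac : Function.FactorsThrough (fun h : H => h.1 x₀) (fun (h : H) (x : F) => h.1 x.1) :=
    fun h h' e => hF h h.2 h' h'.2 fun x hx => congrFun e ⟨x, hx⟩
  exact hfac.extend_apply _ h

/-! ### Finite product measures -/

section ProductMeasure

variable {Z : Type*} [MeasurableSpace Z] (P : Measure Z) [IsProbabilityMeasure P]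

/-- Selecting distinct coordinates of an independent sample gives an independent sample. -/
theorem measurePreserving_comp_injective {ι κ : Type*} [Fintype ι] [Fintype κ] {e : ι → κ}
    (he : Function.Injective e) :
    MeasurePreserving (fun ω : κ → Z => ω ∘ e) (Measure.pi fun _ => P) (Measure.pi fun _ => P) := by
  have hm : Measurable (fun ω : κ → Z => ω ∘ e) :=
    measurable_pi_lambda _ fun i => measurable_pi_apply _
  refine ⟨hm, (Measure.pi_eq fun s hs => ?_).symm⟩
  rw [Measure.map_apply hm (MeasurableSet.univ_pi hs)]
  have h1 : (fun ω : κ → Z => ω ∘ e) ⁻¹' Set.univ.pi s =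
      Set.univ.pi (Function.extend e s fun _ => Set.univ) := by
    ext ω
    simp only [Set.mem_preimage, Set.mem_univ_pi, Function.comp_apply]
    constructor
    · intro h j
      by_cases hj : ∃ i, e i = j
      · obtain ⟨i, rfl⟩ := hj
        rw [he.extend_apply]
        exact h i
      · rw [Function.extend_apply' _ _ _ hj]
        trivial
    · intro h i
      simpa only [he.extend_apply] using h (e i)
  rw [h1, Measure.pi_pi]
  refine (Fintype.prod_of_injective e he _ _ (fun j hj => ?_) fun i => ?_).symm
  · rw [Function.extend_apply' _ _ _ (by simpa using hj)]
    exact measure_univ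
  · rw [he.extend_apply]

theorem measurePreserving_curry (ι κ : Type*) [Fintype ι] [Fintype κ] :
    MeasurePreserving (fun (ω : ι × κ → Z) (i : ι) (j : κ) => ω (i, j))
      (Measure.pi fun _ => P) (Measure.pi fun _ => Measure.pi fun _ => P) := by
  have h : MeasurePreserving (MeasurableEquiv.curry ι κ Z).symm
      (Measure.pi fun _ : ι => Measure.pi fun _ : κ => P) (Measure.pi fun _ => P) := by
    refine ⟨(MeasurableEquiv.curry ι κ Z).symm.measurable, (Measure.pi_eq fun s hs => ?_).symm⟩
    rw [MeasurableEquiv.map_apply]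
    have h1 : (MeasurableEquiv.curry ι κ Z).symm ⁻¹' Set.univ.pi s =
        Set.univ.pi fun i => Set.univ.pi fun j => s (i, j) := by
      ext ω
      simp only [Set.mem_preimage, Set.mem_univ_pi, Prod.forall]
      rfl
    rw [h1, Measure.pi_pi, Fintype.prod_prod_type]
    simp only [Measure.pi_pi]
  exact h.symm

/-- Cutting an independent sample into disjoint blocks gives independent blocks. -/
theorem measurePreserving_blocks {ι κ n : Type*} [Fintype ι] [Fintype κ] [Fintype n]
    {e : ι × κ → n} (he : Function.Injective e) :
    MeasurePreserving (fun (ω : n → Z) (i : ι) (j : κ) => ω (e (i, j)))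
      (Measure.pi fun _ => P) (Measure.pi fun _ => Measure.pi fun _ => P) :=
  (measurePreserving_curry P ι κ).comp (measurePreserving_comp_injective P he)

end ProductMeasure

/-- Either some value of `F` has a large probability, or two independent values are likely to
differ. -/
theorem exists_atom_or_le_prod_ne {Ω B : Type*} [MeasurableSpace Ω] [DiscreteMeasurableSpace Ω]
    [Countable Ω] (μ : Measure Ω) [IsProbabilityMeasure μ] (F : Ω → B) (G : Set Ω)
    {p : ENNReal} (hp : p ≤ μ G) :
    (∃ f, p / 2 ≤ μ {ω | ω ∈ G ∧ F ω = f}) ∨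
      p / 2 * p ≤ (μ.prod μ) {ω | ω.1 ∈ G ∧ ω.2 ∈ G ∧ F ω.1 ≠ F ω.2} := by
  by_contra! hcon
  obtain ⟨h1, h2⟩ := hcon
  refine absurd h2 (not_lt.2 ?_)
  have hlow : ∀ ω ∈ G, p / 2 ≤ μ {ω' | ω' ∈ G ∧ F ω ≠ F ω'} := by
    intro ω _
    by_contra! hlt
    have hlt' := ENNReal.add_lt_add (h1 (F ω)) hlt
    rw [ENNReal.add_halves] at hlt'
    refine absurd (hp.trans ?_) (not_le.2 hlt')
    refine (measure_mono fun ω' hω' => ?_).trans (measure_union_le _ _)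
    by_cases he : F ω' = F ω
    · exact Or.inl ⟨hω', he⟩
    · exact Or.inr ⟨hω', fun h => he h.symm⟩
  rw [Measure.prod_apply (MeasurableSet.of_discrete)]
  calc p / 2 * p ≤ p / 2 * μ G := by gcongr
    _ = ∫⁻ _ in G, p / 2 ∂μ := by rw [setLIntegral_const]
    _ ≤ ∫⁻ ω in G, μ {ω' | ω' ∈ G ∧ F ω ≠ F ω'} ∂μ :=
      setLIntegral_mono (measurable_of_countable _) hlow
    _ = ∫⁻ ω in G, μ (Prod.mk ω ⁻¹' {ω | ω.1 ∈ G ∧ ω.2 ∈ G ∧ F ω.1 ≠ F ω.2}) ∂μ := by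
      refine setLIntegral_congr_fun (MeasurableSet.of_discrete) fun ω hω => ?_
      congr 1
      ext ω'
      simp [hω]
    _ ≤ _ := setLIntegral_le_lintegral _ _

/-! ### The stable learner -/

/-- The hypotheses in `V` consistent with the labelled sample `S`. -/
def versionSpace {X Y ι : Type*} (V : Set (X → Y)) (S : ι → X × Y) : Set (X → Y) :=
  {h ∈ V | ∀ i, h (S i).1 = (S i).2}

/-- The positions in the sample of a `k`-round tournament: each round plays two independent copies of
the previous one against each other, each followed by `m` fresh examples. -/
def TournamentIdx (m : ℕ) : ℕ → Type
  | 0 => Empty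
  | k + 1 => (TournamentIdx m k ⊕ Fin m) ⊕ (TournamentIdx m k ⊕ Fin m)

instance TournamentIdx.instFintype (m : ℕ) : ∀ k, Fintype (TournamentIdx m k)
  | 0 => inferInstanceAs (Fintype Empty)
  | k + 1 =>
    letI := TournamentIdx.instFintype m k
    inferInstanceAs (Fintype ((TournamentIdx m k ⊕ Fin m) ⊕ (TournamentIdx m k ⊕ Fin m)))

theorem TournamentIdx.card (m k : ℕ) :
    Fintype.card (TournamentIdx m k ⊕ Fin m) = (2 ^ (k + 1) - 1) * m := by
  induction k with
  | zero =>
    have : Fintype.card (TournamentIdx m 0) = 0 := Fintype.card_eq_zero_iff.2 ⟨fun x : Empty => x.elim⟩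
    simp [this]
  | succ k ih =>
    have : Fintype.card (TournamentIdx m (k + 1)) =
        Fintype.card ((TournamentIdx m k ⊕ Fin m) ⊕ (TournamentIdx m k ⊕ Fin m)) := rfl
    rw [Fintype.card_sum, this, Fintype.card_sum, ih, Fintype.card_fin, ← add_mul, ← add_one_mul]
    congr 1
    have := Nat.one_le_two_pow (n := k + 1)
    rw [pow_succ 2 (k + 1)]
    omega

/-- The guesses made in a `k`-round tournament. In each round either nothing is done, or the label of
the point of disagreement and the copy that mispredicts it are guessed. -/
def TournamentAdvice (K : ℕ) : ℕ → Type
  | 0 => Unit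
  | k + 1 => TournamentAdvice K k × Option (Fin K × Bool)

instance TournamentAdvice.instFintype (K : ℕ) : ∀ k, Fintype (TournamentAdvice K k)
  | 0 => inferInstanceAs (Fintype Unit)
  | k + 1 =>
    letI := TournamentAdvice.instFintype K k
    inferInstanceAs (Fintype (TournamentAdvice K k × Option (Fin K × Bool)))

section Tournament

variable {X : Type*} {K : ℕ} [NeZero K] (m : ℕ) (H : Set (X → Fin K))

open Classical in
/-- The version space after `k` tournament rounds with the given guesses. In a round, if the standard
optimal algorithm ends up with two different predictors on the two copies, a point where they differ
is added, with the guessed label, to the copy that is guessed to mispredict it. -/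
noncomputable def tournamentSpace : ∀ k : ℕ, TournamentAdvice K k →
    (TournamentIdx m k → X × Fin K) → Set (X → Fin K)
  | 0, _, _ => H
  | k + 1, (a, none), S => tournamentSpace k a (S ∘ Sum.inl ∘ Sum.inl)
  | k + 1, (a, some (y, b)), S =>
    let U := versionSpace (tournamentSpace k a (S ∘ Sum.inl ∘ Sum.inl)) (S ∘ Sum.inl ∘ Sum.inr)
    let U' := versionSpace (tournamentSpace k a (S ∘ Sum.inr ∘ Sum.inl)) (S ∘ Sum.inr ∘ Sum.inr)
    if hne : ∃ x, soa U x ≠ soa U' x then {h ∈ (if b then U else U') | h hne.choose = y} else ∅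

/-- The predictor of the standard optimal algorithm after `k` tournament rounds and `m` fresh
examples. -/
noncomputable def tournamentLearner (k : ℕ) (a : TournamentAdvice K k)
    (S : TournamentIdx m k ⊕ Fin m → X × Fin K) : X → Fin K :=
  soa (versionSpace (tournamentSpace m H k a (S ∘ Sum.inl)) (S ∘ Sum.inr))

theorem tournamentSpace_subset : ∀ (k : ℕ) (a : TournamentAdvice K k)
    (S : TournamentIdx m k → X × Fin K), tournamentSpace m H k a S ⊆ H
  | 0, _, _ => subset_rfl
  | k + 1, (a, none), S => tournamentSpace_subset k a _
  | k + 1, (a, some (y, b)), S => by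
    intro h hh
    simp only [tournamentSpace] at hh
    split_ifs at hh with hne hb
    · exact tournamentSpace_subset k a _ hh.1.1
    · exact tournamentSpace_subset k a _ hh.1.1
    · exact hh.elim

variable {m H}

/-- A tournament round between two copies that both contain the target but predict differently lowers
the Littlestone dimension without losing the target, if the guesses of this round are right. -/
theorem exists_advice_of_disagree {k r : ℕ} {a : TournamentAdvice K k} {hs : X → Fin K}
    {S : TournamentIdx m (k + 1) → X × Fin K} {U : Bool → Set (X → Fin K)}
    (hU : U true =
      versionSpace (tournamentSpace m H k a (S ∘ Sum.inl ∘ Sum.inl)) (S ∘ Sum.inl ∘ Sum.inr))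
    (hU' : U false =
      versionSpace (tournamentSpace m H k a (S ∘ Sum.inr ∘ Sum.inl)) (S ∘ Sum.inr ∘ Sum.inr))
    (hmem : ∀ b, hs ∈ U b) (hr : ∀ b, ¬ ShattersDepth (U b) (r + 1))
    (hne : soa (U true) ≠ soa (U false)) :
    ∃ yb : Fin K × Bool, hs ∈ tournamentSpace m H (k + 1) (a, some yb) S ∧
      ¬ ShattersDepth (tournamentSpace m H (k + 1) (a, some yb) S) r := by
  have hex : ∃ x, soa (U true) x ≠ soa (U false) x := Function.ne_iff.1 hne
  have heq (y : Fin K) (b : Bool) : tournamentSpace m H (k + 1) (a, some (y, b)) S =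
      {h ∈ U b | h hex.choose = y} := by
    have : tournamentSpace m H (k + 1) (a, some (y, b)) S =
        {h ∈ (if b then U true else U false) | h hex.choose = y} := by
      simp only [hU, hU', tournamentSpace]
      rw [dif_pos]
    rw [this]
    cases b <;> rfl
  obtain ⟨b, hb⟩ : ∃ b, soa (U b) hex.choose ≠ hs hex.choose := by
    by_contra! hcon
    exact hex.choose_spec ((hcon true).trans (hcon false).symm)
  refine ⟨(hs hex.choose, b), ?_⟩
  rw [heq]
  exact ⟨⟨hmem b, rfl⟩, not_shattersDepth_of_soa_ne (hr b) hb⟩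

end Tournament

/-- The lower bound for the probability that the right guesses let a tournament lower the
Littlestone dimension `k` times. -/
noncomputable def tournamentProb (K : ℕ) : ℕ → ENNReal
  | 0 => 1
  | k + 1 => tournamentProb K k / 2 * tournamentProb K k / (K * 2)

theorem tournamentProb_succ_le_of_le_one {K : ℕ} (hK : 1 ≤ K) {k : ℕ}
    (h : tournamentProb K k ≤ 1) : tournamentProb K (k + 1) ≤ tournamentProb K k := by
  have hK' : (1 : ENNReal) ≤ K := by exact_mod_cast hK
  refine ENNReal.div_le_of_le_mul ?_
  rw [mul_comm]
  gcongr
  calc tournamentProb K k / 2 ≤ 1 := ENNReal.half_le_self.trans h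
    _ ≤ K * 2 := one_le_mul_of_one_le_of_one_le hK' (by norm_num)

theorem tournamentProb_le_one {K : ℕ} (hK : 1 ≤ K) (k : ℕ) : tournamentProb K k ≤ 1 := by
  induction k with
  | zero => exact le_rfl
  | succ k ih => exact (tournamentProb_succ_le_of_le_one hK ih).trans ih

theorem tournamentProb_ne_zero (K : ℕ) (k : ℕ) : tournamentProb K k ≠ 0 := by
  induction k with
  | zero => simp [tournamentProb]
  | succ k ih => simp [tournamentProb, ih, ENNReal.mul_eq_top]

section Stability

variable {X : Type*} {K : ℕ} [NeZero K] {m d : ℕ} {H : Set (X → Fin K)}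
  {Z : Type*} [MeasurableSpace Z] [Countable Z] [DiscreteMeasurableSpace Z]
  {P : Measure Z} [IsProbabilityMeasure P] {v : Z → X × Fin K} {hs : X → Fin K}

theorem stable_or_progress (hH : ¬ ShattersDepth H (d + 1)) (hsH : hs ∈ H)
    (hv : ∀ᵐ z ∂P, hs (v z).1 = (v z).2) (k : ℕ) (hk : k ≤ d + 1) :
    (∃ a f, tournamentProb K k / 2 ≤ (Measure.pi fun _ => P)
      {S | hs ∈ tournamentSpace m H k a (v ∘ S ∘ Sum.inl) ∧
        tournamentLearner m H k a (v ∘ S) = f}) ∨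
    ∃ a, tournamentProb K k ≤ (Measure.pi fun _ => P)
      {S | hs ∈ tournamentSpace m H k a (v ∘ S) ∧
        ¬ ShattersDepth (tournamentSpace m H k a (v ∘ S)) (d + 1 - k)} := by
  induction k with
  | zero =>
    refine Or.inr ⟨(), ?_⟩
    simp [tournamentProb, tournamentSpace, hsH, hH]
  | succ k ih =>
    have hstep : (∃ a f, tournamentProb K k / 2 ≤ (Measure.pi fun _ => P)
      {S | hs ∈ tournamentSpace m H k a (v ∘ S ∘ Sum.inl) ∧
        tournamentLearner m H k a (v ∘ S) = f}) →
      (∃ a f, tournamentProb K (k + 1) / 2 ≤ (Measure.pi fun _ => P)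
      {S | hs ∈ tournamentSpace m H (k + 1) a (v ∘ S ∘ Sum.inl) ∧
        tournamentLearner m H (k + 1) a (v ∘ S) = f}) := by
      rintro ⟨a, f, h⟩
      refine ⟨(a, none), f, ?_⟩
      have hinj : Function.Injective
          (Sum.map (fun i => Sum.inl (Sum.inl i)) id :
            TournamentIdx m k ⊕ Fin m → TournamentIdx m (k + 1) ⊕ Fin m) :=
        Function.Injective.sumMap (Sum.inl_injective.comp Sum.inl_injective)
          Function.injective_id
      refine (ENNReal.div_le_div_right
        (tournamentProb_succ_le_of_le_one NeZero.one_le (tournamentProb_le_one NeZero.one_le k)) 2).trans (h.trans ?_)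
      rw [← (measurePreserving_comp_injective P hinj).measure_preimage
        MeasurableSet.of_discrete.nullMeasurableSet]
      exact le_rfl
    rcases ih (by omega) with h | ⟨a, ha⟩
    · exact Or.inl (hstep h)
    let G : Set (TournamentIdx m k ⊕ Fin m → Z) :=
      {S | hs ∈ tournamentSpace m H k a (v ∘ S ∘ Sum.inl) ∧
        ¬ ShattersDepth (tournamentSpace m H k a (v ∘ S ∘ Sum.inl)) (d + 1 - k) ∧
        ∀ j, hs (v (S (Sum.inr j))).1 = (v (S (Sum.inr j))).2}
    have hG : tournamentProb K k ≤ (Measure.pi fun _ => P) G := by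
      rw [← (measurePreserving_comp_injective P
        (Sum.inl_injective (α := TournamentIdx m k) (β := Fin m))).measure_preimage
        MeasurableSet.of_discrete.nullMeasurableSet] at ha
      refine ha.trans (measure_mono_ae ?_)
      have hae : ∀ᵐ S ∂(Measure.pi fun _ : TournamentIdx m k ⊕ Fin m => P), ∀ i,
          hs (v (S i)).1 = (v (S i)).2 :=
        eventually_all.2 fun i => (measurePreserving_eval (fun _ => P) i).quasiMeasurePreserving.ae hv
      filter_upwards [hae] with S hS hS'
      exact ⟨hS'.1, hS'.2, fun j => hS _⟩
    rcases exists_atom_or_le_prod_ne _ (fun S => tournamentLearner m H k a (v ∘ S)) G hG with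
      ⟨f, hf⟩ | hne
    · exact Or.inl (hstep ⟨a, f, hf.trans (measure_mono fun S hS => ⟨hS.1.1, hS.2⟩)⟩)
    right
    let E (yb : Fin K × Bool) : Set (TournamentIdx m (k + 1) → Z) :=
      {S | hs ∈ tournamentSpace m H (k + 1) (a, some yb) (v ∘ S) ∧
        ¬ ShattersDepth (tournamentSpace m H (k + 1) (a, some yb) (v ∘ S)) (d + 1 - (k + 1))}
    have hsum : tournamentProb K k / 2 * tournamentProb K k ≤
        ∑ yb, (Measure.pi fun _ => P) (E yb) := by
      refine hne.trans (le_trans ?_ (measure_iUnion_fintype_le _ _))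
      have hmp := measurePreserving_sumPiEquivProdPi
        (fun _ : (TournamentIdx m k ⊕ Fin m) ⊕ (TournamentIdx m k ⊕ Fin m) => P)
      rw [← hmp.measure_preimage MeasurableSet.of_discrete.nullMeasurableSet]
      refine measure_mono fun S hS => ?_
      obtain ⟨h1, h2, h3⟩ := hS
      have hr : d + 1 - k = d + 1 - (k + 1) + 1 := by omega
      let U (b : Bool) : Set (X → Fin K) := if b then
        versionSpace (tournamentSpace m H k a ((v ∘ S) ∘ Sum.inl ∘ Sum.inl))
          ((v ∘ S) ∘ Sum.inl ∘ Sum.inr)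
        else versionSpace (tournamentSpace m H k a ((v ∘ S) ∘ Sum.inr ∘ Sum.inl))
          ((v ∘ S) ∘ Sum.inr ∘ Sum.inr)
      obtain ⟨yb, hyb⟩ := exists_advice_of_disagree (m := m) (H := H) (r := d + 1 - (k + 1))
        (a := a) (hs := hs) (S := v ∘ S) (U := U) rfl rfl
        (by
          rintro (_ | _)
          · exact ⟨h2.1, h2.2.2⟩
          · exact ⟨h1.1, h1.2.2⟩)
        (by
          rw [← hr]
          rintro (_ | _) hsh
          · exact h2.2.1 (hsh.mono (Set.sep_subset _ _))
          · exact h1.2.1 (hsh.mono (Set.sep_subset _ _)))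
        h3
      exact Set.mem_iUnion.2 ⟨yb, hyb⟩
    by_contra! hcon
    have hlt : ∑ yb, (Measure.pi fun _ => P) (E yb) <
        ∑ _yb : Fin K × Bool, tournamentProb K (k + 1) :=
      ENNReal.sum_lt_sum_of_nonempty ⟨(0, true), Finset.mem_univ _⟩ fun yb _ => hcon (a, some yb)
    refine absurd hsum (not_le.2 (hlt.trans_le ?_))
    simp only [Finset.sum_const, Finset.card_univ, Fintype.card_prod, Fintype.card_fin,
      Fintype.card_bool, nsmul_eq_mul, tournamentProb]
    push_cast
    exact ENNReal.mul_div_le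

/-- **Global stability**: for every realizable distribution, with suitable guesses the tournament
learner outputs one particular hypothesis, consistent with its `m` fresh examples, with a probability
that depends on `K` and `d` only. -/
theorem exists_stable_hypothesis (hH : ¬ ShattersDepth H (d + 1)) (hsH : hs ∈ H)
    (hv : ∀ᵐ z ∂P, hs (v z).1 = (v z).2) :
    ∃ a f, tournamentProb K (d + 1) / 2 ≤ (Measure.pi fun _ => P)
      {S | tournamentLearner m H (d + 1) a (v ∘ S) = f ∧
        ∀ j, f (v (S (Sum.inr j))).1 = (v (S (Sum.inr j))).2} := by
  rcases stable_or_progress (m := m) hH hsH hv (d + 1) le_rfl with ⟨a, f, h⟩ | ⟨a, h⟩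
  · refine ⟨a, f, h.trans (measure_mono_ae ?_)⟩
    have hae : ∀ᵐ S ∂(Measure.pi fun _ : TournamentIdx m (d + 1) ⊕ Fin m => P), ∀ i,
        hs (v (S i)).1 = (v (S i)).2 :=
      eventually_all.2 fun i => (measurePreserving_eval (fun _ => P) i).quasiMeasurePreserving.ae hv
    filter_upwards [hae] with S hS hS'
    refine ⟨hS'.2, fun j => ?_⟩
    rw [← hS'.2]
    exact soa_eq_of_forall
      (fun hsh => hH (hsh.mono ((Set.sep_subset _ _).trans (tournamentSpace_subset _ _ _ _ _))))
      ⟨hs, hS'.1, fun i => hS _⟩ fun h hh => hh.2 j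
  · -- After `d + 1` reductions the version space would be empty, yet contain the target.
    have hemp : {S : TournamentIdx m (d + 1) → Z |
        hs ∈ tournamentSpace m H (d + 1) a (v ∘ S) ∧
        ¬ ShattersDepth (tournamentSpace m H (d + 1) a (v ∘ S)) (d + 1 - (d + 1))} = ∅ := by
      refine Set.eq_empty_of_forall_notMem fun S hS => hS.2 ?_
      rw [Nat.sub_self]
      exact ShattersDepth.zero_iff.2 ⟨hs, hS.1⟩
    rw [hemp, measure_empty] at h
    exact absurd (le_zero_iff.1 h) (tournamentProb_ne_zero K _)

end Stability

/-! ### A truncated exponential mechanism for votes -/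

section Vote

variable {F : Type*} {k : ℕ}

open Classical in
/-- The number of ballots that list `f`. -/
noncomputable def voteCount (B : Fin k → Finset F) (f : F) : ℕ :=
  (Finset.univ.filter fun i => f ∈ B i).card

/-- The unnormalized output probabilities: `exp (ε q) - 1` for a candidate with `q` votes, so that
candidates without votes are never output, and `M` for the abstention `none`. -/
noncomputable def voteWeight (ε M : ℝ) (B : Fin k → Finset F) : Option F → ENNReal
  | none => ENNReal.ofReal M
  | some f => ENNReal.ofReal (Real.exp (ε * voteCount B f) - 1)

variable {ε M : ℝ} {B B' : Fin k → Finset F}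

theorem voteCount_eq_zero {f : F} (h : ∀ i, f ∉ B i) : voteCount B f = 0 := by
  simp [voteCount, h]

open Classical in
theorem pow_voteCount (B : Fin k → Finset F) (f : F) (u : ENNReal) :
    u ^ voteCount B f = ∏ i, if f ∈ B i then u else 1 := by
  rw [Finset.prod_ite, Finset.prod_const, Finset.prod_const_one, mul_one]
  rfl

open Classical in
theorem tsum_voteWeight_ne_top : ∑' o, voteWeight ε M B o ≠ ⊤ := by
  rw [tsum_eq_sum (s := Finset.insertNone (Finset.univ.biUnion B))]
  · refine ENNReal.sum_ne_top.2 fun o _ => ?_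
    cases o <;> exact ENNReal.ofReal_ne_top
  · intro o ho
    cases o with
    | none => simp at ho
    | some f =>
      have : voteCount B f = 0 := voteCount_eq_zero fun i hi => ho (by simpa using ⟨i, hi⟩)
      simp [voteWeight, this]

theorem le_tsum_voteWeight : ENNReal.ofReal M ≤ ∑' o, voteWeight ε M B o :=
  ENNReal.le_tsum (none : Option F)

theorem tsum_voteWeight_ne_zero (hM : 0 < M) : ∑' o, voteWeight ε M B o ≠ 0 :=
  ((ENNReal.ofReal_pos.2 hM).trans_le le_tsum_voteWeight).ne'

/-- The truncated exponential mechanism: a candidate is drawn with probability proportional to its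
`voteWeight`. -/
noncomputable def privateVote (ε : ℝ) {M : ℝ} (hM : 0 < M) (B : Fin k → Finset F) :
    PMF (Option F) :=
  PMF.normalize (voteWeight ε M B) (tsum_voteWeight_ne_zero hM) tsum_voteWeight_ne_top

theorem toOuterMeasure_normalize {O : Type*} (w : O → ENNReal) (h0 : tsum w ≠ 0)
    (ht : tsum w ≠ ⊤) (T : Set O) :
    (PMF.normalize w h0 ht).toOuterMeasure T = (∑' o, T.indicator w o) * (∑' o, w o)⁻¹ := by
  rw [PMF.toOuterMeasure_apply, ← ENNReal.tsum_mul_right]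
  refine tsum_congr fun o => ?_
  by_cases ho : o ∈ T <;> simp [ho, PMF.normalize_apply]

theorem toOuterMeasure_normalize_le {O : Type*} {w w' : O → ENNReal} (h0 : tsum w ≠ 0)
    (ht : tsum w ≠ ⊤) (h0' : tsum w' ≠ 0) (ht' : tsum w' ≠ ⊤) {u u' c δ : ENNReal} {T : Set O}
    (hT : ∑' o, T.indicator w o ≤ u * ∑' o, T.indicator w' o + c)
    (hc : c ≤ δ * ∑' o, w o) (hw : ∑' o, w' o ≤ u' * ∑' o, w o) :
    (PMF.normalize w h0 ht).toOuterMeasure T ≤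
      u * u' * (PMF.normalize w' h0' ht').toOuterMeasure T + δ := by
  rw [toOuterMeasure_normalize, toOuterMeasure_normalize]
  calc (∑' o, T.indicator w o) * (∑' o, w o)⁻¹
      ≤ (u * ∑' o, T.indicator w' o + δ * ∑' o, w o) * (∑' o, w o)⁻¹ := by
        gcongr
        exact hT.trans (by gcongr)
    _ = u * (∑' o, T.indicator w' o) * (∑' o, w o)⁻¹ + δ := by
        rw [add_mul, mul_assoc δ, ENNReal.mul_inv_cancel h0 ht, mul_one]
    _ ≤ u * (∑' o, T.indicator w' o) * (u' * (∑' o, w' o)⁻¹) + δ := by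
        gcongr
        rw [ENNReal.inv_le_iff_le_mul (fun _ => h0) (fun h => absurd h ht)]
        calc (1 : ENNReal) = (∑' o, w' o) * (∑' o, w' o)⁻¹ := (ENNReal.mul_inv_cancel h0' ht').symm
          _ ≤ (u' * ∑' o, w o) * (∑' o, w' o)⁻¹ := by gcongr
          _ = _ := by ring
    _ = _ := by ring

open Classical in
theorem voteCount_le_of_agree {i₀ : Fin k} (h : ∀ i, i ≠ i₀ → B i = B' i) (f : F) :
    voteCount B f ≤ voteCount B' f + if f ∈ B i₀ then 1 else 0 := by
  have h1 : (Finset.univ.filter fun i => f ∈ B i) ⊆ (Finset.univ.filter fun i => f ∈ B' i) ∪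
      if f ∈ B i₀ then {i₀} else ∅ := by
    intro i hi
    by_cases hii : i = i₀
    · subst hii
      have : f ∈ B i := by simpa using hi
      simp [this]
    · rw [Finset.mem_union]
      left
      simpa [h i hii] using hi
  refine (Finset.card_le_card h1).trans ((Finset.card_union_le _ _).trans ?_)
  unfold voteCount
  gcongr
  split_ifs <;> simp

open Classical in
theorem tsum_indicator_voteWeight_le (hε : 0 ≤ ε) {i₀ : Fin k} (h : ∀ i, i ≠ i₀ → B i = B' i)
    (T : Set (Option F)) :
    ∑' o, T.indicator (voteWeight ε M B) o ≤
      ENNReal.ofReal (Real.exp ε) * ∑' o, T.indicator (voteWeight ε M B') o +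
        ENNReal.ofReal (Real.exp ε - 1) * (B i₀).card := by
  have hu : 1 ≤ Real.exp ε := Real.one_le_exp hε
  let r : Option F → ENNReal := fun o =>
    o.elim 0 fun f => if f ∈ B i₀ then ENNReal.ofReal (Real.exp ε - 1) else 0
  have hpt : ∀ o, voteWeight ε M B o ≤
      ENNReal.ofReal (Real.exp ε) * voteWeight ε M B' o + r o := by
    intro o
    cases o with
    | none =>
      refine le_add_right ?_
      exact le_mul_of_one_le_left zero_le (ENNReal.one_le_ofReal.2 hu)
    | some f =>
      have hq : (voteCount B f : ℝ) ≤ voteCount B' f + if f ∈ B i₀ then 1 else 0 := by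
        exact_mod_cast voteCount_le_of_agree h f
      have h1 : 1 ≤ Real.exp (ε * voteCount B' f) := Real.one_le_exp (by positivity)
      by_cases hf : f ∈ B i₀
      · simp only [voteWeight, r, Option.elim, hf, if_true] at hq ⊢
        rw [← ENNReal.ofReal_mul (by positivity), ← ENNReal.ofReal_add
          (mul_nonneg (by positivity) (by linarith)) (by linarith)]
        refine ENNReal.ofReal_le_ofReal ?_
        have : Real.exp (ε * voteCount B f) ≤ Real.exp ε * Real.exp (ε * voteCount B' f) := by
          rw [← Real.exp_add]
          refine Real.exp_le_exp.2 ?_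
          nlinarith
        nlinarith
      · simp only [voteWeight, r, Option.elim, hf, if_false, add_zero] at hq ⊢
        rw [← ENNReal.ofReal_mul (by positivity)]
        refine ENNReal.ofReal_le_ofReal ?_
        have : Real.exp (ε * voteCount B f) ≤ Real.exp (ε * voteCount B' f) :=
          Real.exp_le_exp.2 (by gcongr)
        nlinarith
  have hr : ∑' o, r o = ENNReal.ofReal (Real.exp ε - 1) * (B i₀).card := by
    rw [tsum_eq_sum (s := (B i₀).map Function.Embedding.some)]
    · rw [Finset.sum_map, mul_comm, ← nsmul_eq_mul, ← Finset.sum_const]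
      exact Finset.sum_congr rfl fun f hf => by simp [r, hf]
    · intro o ho
      cases o with
      | none => rfl
      | some f =>
        have : f ∉ B i₀ := by simpa using ho
        simp [r, this]
  rw [← hr, ← ENNReal.tsum_mul_left, ← ENNReal.tsum_add]
  refine ENNReal.tsum_le_tsum fun o => ?_
  by_cases ho : o ∈ T
  · simpa [ho] using hpt o
  · simp [ho]

/-- Changing one ballot, of at most `L` candidates, is hidden by the mechanism if the abstention has
weight `L / δ`. -/
theorem privateVote_le (hε : 0 ≤ ε) (hε' : ε ≤ 1 / 3) {L : ℕ} {δ : ℝ} (hδ : 0 < δ) (hδ' : δ ≤ 1)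
    (hM : 0 < L / δ) {i₀ : Fin k} (h : ∀ i, i ≠ i₀ → B i = B' i) (hL : (B i₀).card ≤ L)
    (hL' : (B' i₀).card ≤ L) (T : Set (Option F)) :
    (privateVote ε hM B).toOuterMeasure T ≤
      ENNReal.ofReal (Real.exp (3 * ε)) * (privateVote ε hM B').toOuterMeasure T +
        ENNReal.ofReal δ := by
  have hu : 1 ≤ Real.exp ε := Real.one_le_exp hε
  have hu2 : Real.exp ε ≤ 2 := by
    refine (Real.exp_le_exp.2 hε').trans ?_
    have := Real.exp_bound_div_one_sub_of_interval (x := 1 / 3) (by norm_num) (by norm_num)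
    refine this.trans (by norm_num)
  have hc : ENNReal.ofReal (Real.exp ε - 1) * (L : ENNReal) ≤
      ENNReal.ofReal (δ * (Real.exp ε - 1)) * ∑' o, voteWeight ε (L / δ) B o := by
    refine le_trans ?_ (mul_le_mul_right (le_tsum_voteWeight (ε := ε) (B := B)) _)
    rw [← ENNReal.ofReal_natCast, ← ENNReal.ofReal_mul (by linarith),
      ← ENNReal.ofReal_mul (mul_nonneg hδ.le (by linarith))]
    refine ENNReal.ofReal_le_ofReal (le_of_eq ?_)
    field_simp
  have e3 : ENNReal.ofReal (Real.exp (3 * ε)) =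
      ENNReal.ofReal (Real.exp ε) * ENNReal.ofReal (Real.exp (2 * ε)) := by
    rw [← ENNReal.ofReal_mul (by positivity), ← Real.exp_add]
    ring_nf
  rw [e3]
  refine toOuterMeasure_normalize_le _ _ _ _ (c := ENNReal.ofReal (Real.exp ε - 1) * (L : ENNReal))
    ?_ ?_ ?_
  · refine (tsum_indicator_voteWeight_le hε h T).trans ?_
    gcongr
  · refine hc.trans ?_
    gcongr
    nlinarith
  · have h1 := tsum_indicator_voteWeight_le (M := L / δ) hε (fun i hi => (h i hi).symm) Set.univ
    simp only [Set.indicator_univ] at h1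
    calc ∑' o, voteWeight ε (L / δ) B' o
        ≤ ENNReal.ofReal (Real.exp ε) * ∑' o, voteWeight ε (L / δ) B o +
          ENNReal.ofReal (Real.exp ε - 1) * (L : ENNReal) := by
          refine h1.trans ?_
          gcongr
      _ ≤ ENNReal.ofReal (Real.exp ε) * ∑' o, voteWeight ε (L / δ) B o +
          ENNReal.ofReal (δ * (Real.exp ε - 1)) * ∑' o, voteWeight ε (L / δ) B o := by gcongr
      _ = ENNReal.ofReal (Real.exp ε + δ * (Real.exp ε - 1)) *
          ∑' o, voteWeight ε (L / δ) B o := by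
          rw [← add_mul, ← ENNReal.ofReal_add (by positivity) (mul_nonneg hδ.le (by linarith))]
      _ ≤ _ := by
          gcongr
          rw [two_mul, Real.exp_add]
          nlinarith

/-- The probability of abstaining or choosing a candidate in `Bad`, in terms of the votes of any
other candidate. -/
theorem privateVote_bad_le (hε : 0 ≤ ε) (hM : 0 < M) (Bad : Set F) (f₀ : F) {c : ℝ}
    (hc : c ≤ voteCount B f₀) :
    (privateVote ε hM B).toOuterMeasure ({none} ∪ some '' Bad) ≤
      (ENNReal.ofReal M + ENNReal.ofReal ε * ∑ i, ∑ f ∈ B i, Bad.indicator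
        (fun f => ENNReal.ofReal (Real.exp ε) ^ voteCount B f) f) *
      (ENNReal.ofReal (Real.exp (ε * c) - 1))⁻¹ := by
  classical
  have hconv (f : F) :
      ENNReal.ofReal ε * Bad.indicator (fun f => ENNReal.ofReal (Real.exp ε) ^ voteCount B f) f =
        Bad.indicator (fun f => ENNReal.ofReal (ε * Real.exp (ε * voteCount B f))) f := by
    by_cases hf : f ∈ Bad
    · simp only [Set.indicator_of_mem hf]
      rw [ENNReal.ofReal_mul hε, mul_comm ε (voteCount B f), Real.exp_nat_mul,
        ENNReal.ofReal_pow (Real.exp_pos ε).le]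
    · simp [hf]
  simp_rw [Finset.mul_sum, hconv]
  rw [privateVote, toOuterMeasure_normalize]
  refine mul_le_mul' ?_ (ENNReal.inv_le_inv.2 ?_)
  · rw [tsum_eq_sum (s := Finset.insertNone (Finset.univ.biUnion B)), Finset.sum_insertNone]
    · have h1 : ∀ f, ({none} ∪ some '' Bad : Set (Option F)).indicator (voteWeight ε M B) (some f) ≤
          ∑ i, if f ∈ B i then Bad.indicator
            (fun f => ENNReal.ofReal (ε * Real.exp (ε * voteCount B f))) f else 0 := by
        intro f
        rw [← Finset.sum_filter, Finset.sum_const]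
        by_cases hf : f ∈ Bad
        · simp only [Set.indicator, Set.mem_union, Set.mem_singleton_iff, reduceCtorEq,
            Set.mem_image, Option.some.injEq, exists_eq_right, hf, or_true, if_true, voteWeight]
          rw [nsmul_eq_mul, ← ENNReal.ofReal_natCast, ← ENNReal.ofReal_mul (by positivity)]
          refine ENNReal.ofReal_le_ofReal ?_
          change Real.exp (ε * voteCount B f) - 1 ≤
            voteCount B f * (ε * Real.exp (ε * voteCount B f))
          -- `exp t - 1 ≤ t * exp t`, from `1 - t ≤ exp (-t)`.
          have h2 := Real.add_one_le_exp (-(ε * voteCount B f))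
          have h3 := mul_le_mul_of_nonneg_right h2 (Real.exp_pos (ε * voteCount B f)).le
          rw [← Real.exp_add, neg_add_cancel, Real.exp_zero] at h3
          linarith
        · simp [hf]
      refine add_le_add ?_ ((Finset.sum_le_sum fun f _ => h1 f).trans (le_of_eq ?_))
      · simp [voteWeight]
      · rw [Finset.sum_comm]
        refine Finset.sum_congr rfl fun i _ => ?_
        rw [← Finset.sum_filter]
        congr 1
        ext f
        simp only [Finset.mem_filter, Finset.mem_biUnion, Finset.mem_univ, true_and]
        exact ⟨fun h => h.2, fun h => ⟨⟨i, h⟩, h⟩⟩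
    · intro o ho
      cases o with
      | none => simp at ho
      | some f =>
        have : voteCount B f = 0 := voteCount_eq_zero fun i hi => ho (by simpa using ⟨i, hi⟩)
        simp [Set.indicator, voteWeight, this]
  · refine le_trans ?_ (ENNReal.le_tsum (some f₀))
    refine ENNReal.ofReal_le_ofReal ?_
    gcongr

end Vote

/-! ### Votes of independent ballots -/

section IndependentVotes

variable {Ω F : Type*} [MeasurableSpace Ω] [Countable Ω] [DiscreteMeasurableSpace Ω]
  (μ : Measure Ω) [IsProbabilityMeasure μ] (B : Ω → Finset F)

theorem lintegral_pi_prod {k : ℕ} (g : Ω → ENNReal) :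
    ∫⁻ ω, ∏ i : Fin k, g (ω i) ∂(Measure.pi fun _ => μ) = (∫⁻ ω, g ω ∂μ) ^ k := by
  have hg : Measurable g := measurable_of_countable g
  rw [ProbabilityTheory.lintegral_prod_eq_prod_lintegral_of_indepFun Finset.univ
    (fun (i : Fin k) (ω : Fin k → Ω) => g (ω i))
    (ProbabilityTheory.iIndepFun_pi (μ := fun _ => μ) fun _ => hg.aemeasurable)
    fun i => measurable_of_countable _]
  have (i : Fin k) : ∫⁻ ω, g (ω i) ∂(Measure.pi fun _ => μ) = ∫⁻ ω, g ω ∂μ :=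
    (measurePreserving_eval (fun _ : Fin k => μ) i).lintegral_comp hg
  simp [this]

open Classical in
theorem lintegral_pow_voteCount {k : ℕ} (f : F) (u : ENNReal) :
    ∫⁻ ω, u ^ voteCount (B ∘ ω) f ∂(Measure.pi fun _ : Fin k => μ) =
      (∫⁻ ω, (if f ∈ B ω then u else 1) ∂μ) ^ k := by
  simp_rw [pow_voteCount, Function.comp_apply]
  exact lintegral_pi_prod μ fun ω => if f ∈ B ω then u else 1

/-- A Chernoff bound: a candidate listed with probability at least `η` is unlikely to receive fewer
than `c` votes. -/
theorem measure_voteCount_lt_le {k : ℕ} (f : F) {η : ℝ} (hη : ENNReal.ofReal η ≤ μ {ω | f ∈ B ω})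
    (c : ℝ) :
    (Measure.pi fun _ : Fin k => μ) {ω | (voteCount (B ∘ ω) f : ℝ) < c} ≤
      ENNReal.ofReal (Real.exp (c - η * k / 2)) := by
  classical
  have hE : ∫⁻ ω, (if f ∈ B ω then ENNReal.ofReal (Real.exp (-1)) else 1) ∂μ ≤
      ENNReal.ofReal (Real.exp (-(η / 2))) := by
    have hA : MeasurableSet {ω | f ∈ B ω} := MeasurableSet.of_discrete
    have h1 : (fun ω => if f ∈ B ω then ENNReal.ofReal (Real.exp (-1)) else 1) =
        fun ω => {ω | f ∈ B ω}.indicator (fun _ => ENNReal.ofReal (Real.exp (-1))) ω +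
          {ω | f ∈ B ω}ᶜ.indicator (fun _ => 1) ω := by
      funext ω
      by_cases hf : f ∈ B ω <;> simp [hf]
    rw [h1, lintegral_add_left (measurable_of_countable _), lintegral_indicator_const hA,
      lintegral_indicator_const hA.compl, one_mul, prob_compl_eq_one_sub hA]
    rw [← ofReal_measureReal] at hη ⊢
    set a := μ.real {ω | f ∈ B ω}
    have ha : a ≤ 1 := measureReal_le_one
    have ha0 : 0 ≤ a := measureReal_nonneg
    have hηa : η ≤ a := by rwa [ENNReal.ofReal_le_ofReal_iff ha0] at hη
    rw [← ENNReal.ofReal_one, ← ENNReal.ofReal_sub _ ha0, ← ENNReal.ofReal_mul (by positivity),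
      ← ENNReal.ofReal_add (by positivity) (by linarith)]
    refine ENNReal.ofReal_le_ofReal ?_
    have h2 : Real.exp (-1) ≤ 1 / 2 := by
      rw [Real.exp_neg, one_div]
      exact inv_anti₀ (by norm_num) (by linarith [Real.add_one_le_exp 1])
    have h3 := Real.add_one_le_exp (-(η / 2))
    nlinarith
  calc (Measure.pi fun _ : Fin k => μ) {ω | (voteCount (B ∘ ω) f : ℝ) < c}
      = ∫⁻ _ in {ω | (voteCount (B ∘ ω) f : ℝ) < c}, 1 ∂(Measure.pi fun _ : Fin k => μ) := by simp
    _ ≤ ∫⁻ ω in {ω | (voteCount (B ∘ ω) f : ℝ) < c}, ENNReal.ofReal (Real.exp c) *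
          ENNReal.ofReal (Real.exp (-1)) ^ voteCount (B ∘ ω) f
          ∂(Measure.pi fun _ : Fin k => μ) := by
        refine setLIntegral_mono (measurable_of_countable _) fun ω hω => ?_
        rw [← ENNReal.ofReal_pow (by positivity), ← ENNReal.ofReal_mul (by positivity),
          ENNReal.one_le_ofReal, ← Real.exp_nat_mul, ← Real.exp_add]
        refine Real.one_le_exp ?_
        have : (voteCount (B ∘ ω) f : ℝ) < c := hω
        linarith
    _ ≤ ∫⁻ ω, ENNReal.ofReal (Real.exp c) *
          ENNReal.ofReal (Real.exp (-1)) ^ voteCount (B ∘ ω) f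
          ∂(Measure.pi fun _ : Fin k => μ) := setLIntegral_le_lintegral _ _
    _ = ENNReal.ofReal (Real.exp c) *
          (∫⁻ ω, (if f ∈ B ω then ENNReal.ofReal (Real.exp (-1)) else 1) ∂μ) ^ k := by
        rw [lintegral_const_mul _ (measurable_of_countable _), lintegral_pow_voteCount]
    _ ≤ ENNReal.ofReal (Real.exp c) * ENNReal.ofReal (Real.exp (-(η / 2))) ^ k := by gcongr
    _ = _ := by
        rw [← ENNReal.ofReal_pow (by positivity), ← ENNReal.ofReal_mul (by positivity),
          ← Real.exp_nat_mul, ← Real.exp_add]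
        congr 2
        ring

/-- Candidates that are each listed with probability at most `q` receive little weight on average,
however many of them there are: the ballots other than the one that nominates a candidate are
independent of it. -/
theorem lintegral_bad_votes_le {k L : ℕ} (hL : ∀ ω, (B ω).card ≤ L) (Bad : Set F) {q u : ENNReal}
    (hu : 1 ≤ u) (hq : ∀ f ∈ Bad, μ {ω | f ∈ B ω} ≤ q) :
    ∫⁻ ω, ∑ i, ∑ f ∈ B (ω i), Bad.indicator (fun f => u ^ voteCount (B ∘ ω) f) f
      ∂(Measure.pi fun _ : Fin k => μ) ≤ k * (L * (u * (1 + (u - 1) * q) ^ k)) := by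
  classical
  rw [lintegral_finsetSum _ fun i _ => measurable_of_countable _]
  have hmain : ∀ i : Fin k, ∫⁻ ω, ∑ f ∈ B (ω i), Bad.indicator
      (fun f => u ^ voteCount (B ∘ ω) f) f ∂(Measure.pi fun _ : Fin k => μ) ≤
      L * (u * (1 + (u - 1) * q) ^ k) := by
    intro i
    obtain _ | k := k
    · exact i.elim0
    have hmp := (measurePreserving_piFinSuccAbove (fun _ : Fin (k + 1) => μ) i).symm
    rw [← hmp.lintegral_comp (measurable_of_countable _),
      lintegral_prod _ (measurable_of_countable _).aemeasurable]
    calc _ ≤ ∫⁻ _, (L * (u * (1 + (u - 1) * q) ^ (k + 1)) : ENNReal) ∂μ := ?_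
      _ = _ := by simp
    refine lintegral_mono fun ω₀ => ?_
    have hins (ω' : Fin k → Ω) : (MeasurableEquiv.piFinSuccAbove (fun _ => Ω) i).symm (ω₀, ω') =
      i.insertNth (α := fun _ => Ω) ω₀ ω' := rfl
    simp only [hins]
    have hval : ∀ ω' : Fin k → Ω, ∀ f ∈ B ω₀,
        u ^ voteCount (B ∘ i.insertNth (α := fun _ => Ω) ω₀ ω') f =
          u * u ^ voteCount (B ∘ ω') f := by
      intro ω' f hf
      rw [pow_voteCount, pow_voteCount, Fin.prod_univ_succAbove _ i]
      simp [hf]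
    calc _ = ∫⁻ ω', ∑ f ∈ B ω₀, Bad.indicator (fun f => u * u ^ voteCount (B ∘ ω') f) f
          ∂(Measure.pi fun _ : Fin k => μ) := by
          refine lintegral_congr fun ω' => ?_
          rw [Fin.insertNth_apply_same]
          refine Finset.sum_congr rfl fun f hf => ?_
          by_cases hb : f ∈ Bad
          · simp [hb, hval ω' f hf]
          · simp [hb]
      _ = ∑ f ∈ B ω₀, ∫⁻ ω', Bad.indicator (fun f => u * u ^ voteCount (B ∘ ω') f) f
          ∂(Measure.pi fun _ : Fin k => μ) :=
          lintegral_finsetSum _ fun f _ => measurable_of_countable _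
      _ ≤ ∑ _f ∈ B ω₀, u * (1 + (u - 1) * q) ^ (k + 1) := by
          refine Finset.sum_le_sum fun f hf => ?_
          by_cases hb : f ∈ Bad
          · simp only [Set.indicator_of_mem hb]
            rw [lintegral_const_mul _ (measurable_of_countable _), lintegral_pow_voteCount]
            refine mul_le_mul_right ?_ u
            have h1 : (fun ω => if f ∈ B ω then u else 1) =
                fun ω => 1 + {ω | f ∈ B ω}.indicator (fun _ => u - 1) ω := by
              funext ω
              by_cases hf : f ∈ B ω <;> simp [hf, add_tsub_cancel_of_le hu]
            rw [h1, lintegral_add_left (measurable_of_countable _),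
              lintegral_indicator_const MeasurableSet.of_discrete]
            simp only [lintegral_one, measure_univ]
            calc (1 + (u - 1) * μ {ω | f ∈ B ω}) ^ k ≤ (1 + (u - 1) * q) ^ k := by
                  gcongr
                  exact hq f hb
              _ ≤ (1 + (u - 1) * q) ^ (k + 1) :=
                  pow_le_pow_right₀ (le_add_right le_rfl) (Nat.le_succ k)
          · simp [hb]
      _ ≤ _ := by
          rw [Finset.sum_const, nsmul_eq_mul]
          gcongr
          exact hL ω₀
  refine (Finset.sum_le_sum fun i _ => hmain i).trans ?_
  simp

end IndependentVotes

/-! ### The private learner -/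

section Learner

variable {X : Type*} {K : ℕ} [NeZero K] {m d k n : ℕ} {H : Set (X → Fin K)}

open Classical in
variable (m d H) in
/-- The ballot of a block of examples: the outputs of the tournament learner for all guesses that are
consistent with the fresh examples of the block. -/
noncomputable def ballot (S : TournamentIdx m (d + 1) ⊕ Fin m → X × Fin K) : Finset (X → Fin K) :=
  (Finset.univ.image fun a => tournamentLearner m H (d + 1) a S).filter fun f =>
    ∀ j, f (S (Sum.inr j)).1 = (S (Sum.inr j)).2

theorem card_ballot_le (S : TournamentIdx m (d + 1) ⊕ Fin m → X × Fin K) :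
    (ballot m d H S).card ≤ Fintype.card (TournamentAdvice K (d + 1)) := by
  classical
  exact (Finset.card_filter_le _ _).trans Finset.card_image_le

variable (H) in
/-- The learner that cuts (part of) the sample into `k` blocks along `e`, lets each block cast its
ballot, and outputs a candidate by the truncated exponential mechanism, or a constant when the
mechanism abstains. -/
noncomputable def votingLearner (ε : ℝ) {M : ℝ} (hM : 0 < M)
    (e : Fin k × (TournamentIdx m (d + 1) ⊕ Fin m) → Fin n) : RandomizedLearner X K n := fun S =>
  (privateVote ε hM fun i => ballot m d H fun j => S (e (i, j))).map fun o => o.getD fun _ => 0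

theorem isDifferentiallyPrivate_votingLearner {ε δ : ℝ} (hε : 0 < ε) (hε' : ε < 1) (hδ : 0 < δ)
    (hδ' : δ < 1) (hM : 0 < (Fintype.card (TournamentAdvice K (d + 1)) : ℝ) / δ)
    {e : Fin k × (TournamentIdx m (d + 1) ⊕ Fin m) → Fin n} (he : Function.Injective e) :
    IsDifferentiallyPrivate ε δ (votingLearner H (ε / 3) hM e) := by
  rintro S S' ⟨i, -, hi⟩ T
  simp only [votingLearner, PMF.toOuterMeasure_map_apply]
  by_cases hex : ∃ p, e p = i
  · obtain ⟨⟨i₀, j₀⟩, rfl⟩ := hex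
    have h := privateVote_le (ε := ε / 3) (by linarith) (by linarith) hδ hδ'.le hM
      (B := fun i => ballot m d H fun j => S (e (i, j)))
      (B' := fun i => ballot m d H fun j => S' (e (i, j))) (i₀ := i₀)
      (fun i hii => by
        have : (fun j => S (e (i, j))) = fun j => S' (e (i, j)) :=
          funext fun j => hi _ fun h => hii (congrArg Prod.fst (he h))
        simp only [this])
      (card_ballot_le _) (card_ballot_le _) ((fun o => o.getD fun _ => 0) ⁻¹' T)
    rwa [mul_div_cancel₀ ε (by norm_num : (3 : ℝ) ≠ 0)] at h
  · have : ∀ p, S (e p) = S' (e p) := fun p => hi _ fun h => hex ⟨p, h⟩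
    simp only [this]
    exact le_add_right (le_mul_of_one_le_left zero_le
      (ENNReal.one_le_ofReal.2 (Real.one_le_exp hε.le)))

variable {Z : Type*} [MeasurableSpace Z] [Countable Z] [DiscreteMeasurableSpace Z]
  {P : Measure Z} [IsProbabilityMeasure P] {v : Z → X × Fin K} {hs : X → Fin K}

/-- A hypothesis of large loss is unlikely to be consistent with `m` fresh examples. -/
theorem measure_mem_ballot_le {α q : ℝ} (hα : α ≤ 1) (hq : (1 - α) ^ m ≤ q) {f : X → Fin K}
    (hf : ENNReal.ofReal α < P {z | f (v z).1 ≠ (v z).2}) :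
    (Measure.pi fun _ => P) {S : TournamentIdx m (d + 1) ⊕ Fin m → Z | f ∈ ballot m d H (v ∘ S)} ≤
      ENNReal.ofReal q := by
  let R : Set Z := {z | f (v z).1 = (v z).2}
  have hR : P R ≤ ENNReal.ofReal (1 - α) := by
    have h1 : P Rᶜ = 1 - P R := prob_compl_eq_one_sub MeasurableSet.of_discrete
    have h2 : ENNReal.ofReal α ≤ 1 - P R := h1 ▸ hf.le
    rw [← ofReal_measureReal, ← ENNReal.ofReal_one,
      ← ENNReal.ofReal_sub _ measureReal_nonneg] at h2
    rw [← ofReal_measureReal]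
    have h3 : P.real R ≤ 1 := measureReal_le_one
    rw [ENNReal.ofReal_le_ofReal_iff (by linarith)] at h2
    exact ENNReal.ofReal_le_ofReal (by linarith)
  calc _ ≤ (Measure.pi fun _ => P) ((fun S : TournamentIdx m (d + 1) ⊕ Fin m → Z => S ∘ Sum.inr) ⁻¹'
        Set.univ.pi fun _ => R) := by
        refine measure_mono fun S hS => ?_
        simp only [ballot, Set.mem_ofPred_eq, Finset.mem_filter] at hS
        exact fun j _ => hS.2 j
    _ = P R ^ m := by
        rw [(measurePreserving_comp_injective P Sum.inr_injective).measure_preimage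
          MeasurableSet.of_discrete.nullMeasurableSet, Measure.pi_pi]
        simp
    _ ≤ ENNReal.ofReal (1 - α) ^ m := by gcongr
    _ ≤ _ := by
        rw [← ENNReal.ofReal_pow (by linarith)]
        exact ENNReal.ofReal_le_ofReal hq

/-- The failure probability of the voting learner: the stable hypothesis gets too few votes, or the
mechanism abstains, or it chooses a hypothesis of large loss. -/
theorem lintegral_votingLearner_bad_le (hH : ¬ ShattersDepth H (d + 1)) (hsH : hs ∈ H)
    (hv : ∀ᵐ z ∂P, hs (v z).1 = (v z).2) {ε M α q η : ℝ} (hε : 0 ≤ ε) (hM : 0 < M) (hα : α ≤ 1)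
    (hq : (1 - α) ^ m ≤ q) (hη : ENNReal.ofReal η ≤ tournamentProb K (d + 1) / 2)
    {e : Fin k × (TournamentIdx m (d + 1) ⊕ Fin m) → Fin n} (he : Function.Injective e) :
    ∫⁻ S, (votingLearner H ε hM e (v ∘ S)).toOuterMeasure
        {f | P {z | f (v z).1 ≠ (v z).2} ≤ ENNReal.ofReal α}ᶜ ∂(Measure.pi fun _ : Fin n => P) ≤
      ENNReal.ofReal (Real.exp (-(η * k / 4))) +
      (ENNReal.ofReal M + ENNReal.ofReal ε * (k * (Fintype.card (TournamentAdvice K (d + 1)) *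
        (ENNReal.ofReal (Real.exp ε) *
          (1 + (ENNReal.ofReal (Real.exp ε) - 1) * ENNReal.ofReal q) ^ k)))) *
      (ENNReal.ofReal (Real.exp (ε * (η * k / 4)) - 1))⁻¹ := by
  obtain ⟨a, f₀, hf₀⟩ := exists_stable_hypothesis (m := m) hH hsH hv
  let μ : Measure (TournamentIdx m (d + 1) ⊕ Fin m → Z) := Measure.pi fun _ => P
  let B (S : TournamentIdx m (d + 1) ⊕ Fin m → Z) := ballot m d H (v ∘ S)
  let Bad : Set (X → Fin K) := {f | P {z | f (v z).1 ≠ (v z).2} ≤ ENNReal.ofReal α}ᶜ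
  let c : ℝ := η * k / 4
  have hf₀' : ENNReal.ofReal η ≤ μ {S | f₀ ∈ B S} := by
    refine hη.trans (hf₀.trans (measure_mono fun S hS => ?_))
    simp only [B, ballot, Set.mem_ofPred_eq, Finset.mem_filter, Finset.mem_image, Finset.mem_univ,
      true_and]
    exact ⟨⟨a, hS.1⟩, hS.2⟩
  calc _ ≤ ∫⁻ S, (privateVote ε hM fun i => B fun j => S (e (i, j))).toOuterMeasure
        ({none} ∪ some '' Bad) ∂(Measure.pi fun _ : Fin n => P) := by
        refine lintegral_mono fun S => ?_
        simp only [votingLearner, PMF.toOuterMeasure_map_apply]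
        refine measure_mono fun o ho => ?_
        cases o with
        | none => exact Or.inl rfl
        | some f => exact Or.inr ⟨f, ho, rfl⟩
    _ = ∫⁻ ω, (privateVote ε hM (B ∘ ω)).toOuterMeasure ({none} ∪ some '' Bad)
        ∂(Measure.pi fun _ : Fin k => μ) :=
        (measurePreserving_blocks P he).lintegral_comp (f := fun ω =>
          (privateVote ε hM (B ∘ ω)).toOuterMeasure ({none} ∪ some '' Bad))
          (measurable_of_countable _)
    _ ≤ ∫⁻ ω, ({ω | (voteCount (B ∘ ω) f₀ : ℝ) < c}.indicator (fun _ => 1) ω +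
        (ENNReal.ofReal M + ENNReal.ofReal ε * ∑ i, ∑ f ∈ B (ω i), Bad.indicator
          (fun f => ENNReal.ofReal (Real.exp ε) ^ voteCount (B ∘ ω) f) f) *
        (ENNReal.ofReal (Real.exp (ε * c) - 1))⁻¹) ∂(Measure.pi fun _ : Fin k => μ) := by
        refine lintegral_mono fun ω => ?_
        by_cases hω : (voteCount (B ∘ ω) f₀ : ℝ) < c
        · refine le_add_right ?_
          rw [Set.indicator_of_mem (s := {ω | (voteCount (B ∘ ω) f₀ : ℝ) < c}) hω]
          rw [PMF.toOuterMeasure_apply, ← PMF.tsum_coe (privateVote ε hM (B ∘ ω))]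
          exact ENNReal.tsum_le_tsum fun o => Set.indicator_le_self _ _ _
        · exact le_add_left (privateVote_bad_le hε hM Bad f₀ (not_lt.1 hω))
    _ = (Measure.pi fun _ : Fin k => μ) {ω | (voteCount (B ∘ ω) f₀ : ℝ) < c} +
        (ENNReal.ofReal M + ENNReal.ofReal ε * ∫⁻ ω, ∑ i, ∑ f ∈ B (ω i), Bad.indicator
          (fun f => ENNReal.ofReal (Real.exp ε) ^ voteCount (B ∘ ω) f) f
          ∂(Measure.pi fun _ : Fin k => μ)) *
        (ENNReal.ofReal (Real.exp (ε * c) - 1))⁻¹ := by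
        rw [lintegral_add_left (measurable_of_countable _),
          lintegral_mul_const _ (measurable_of_countable _),
          lintegral_add_left measurable_const, lintegral_const_mul _ (measurable_of_countable _),
          lintegral_indicator_const MeasurableSet.of_discrete]
        simp
    _ ≤ _ := by
        gcongr
        · refine (measure_voteCount_lt_le μ B f₀ hf₀' c).trans (le_of_eq ?_)
          congr 2
          simp only [c]
          ring
        · exact lintegral_bad_votes_le μ B (fun ω => card_ballot_le _) Bad
            (ENNReal.one_le_ofReal.2 (Real.one_le_exp hε))
            fun f hf => measure_mem_ballot_le hα hq (not_le.1 hf)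

end Learner

/-! ### The choice of parameters -/

theorem failure_bound_le {η L e δ β : ℝ} {k : ℕ} (hη : 0 < η) (hη' : η ≤ 1) (hL : 1 ≤ L)
    (he : 0 < e) (he' : e ≤ 1 / 3) (hδ : 0 < δ) (hδ' : δ < 1) (hβ : 0 < β)
    (hk : Real.log (67 * L / (η * δ * β)) ≤ e * η * k / 8) (hβ' : β < 1) :
    Real.exp (-(η * k / 4)) + (L / δ + e * (k * (L * (Real.exp e *
      (1 + (Real.exp e - 1) * (η / 32)) ^ k)))) * (Real.exp (e * (η * k / 4)) - 1)⁻¹ ≤ β := by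
  set t : ℝ := e * η * k / 8 with ht
  have ht0 : 0 ≤ t := by positivity
  set E : ℝ := Real.exp t with hE
  have hpos : 0 < η * δ * β := by positivity
  have hE1 : 67 * L / (η * δ * β) ≤ E := (Real.log_le_iff_le_exp (by positivity)).1 hk
  have hE2 : 67 * L ≤ β * (η * δ * E) := by
    rw [div_le_iff₀ hpos] at hE1
    linarith
  have hEpos : 0 < E := Real.exp_pos t
  have hηδ : η * δ * β ≤ 1 :=
    mul_le_one₀ (mul_le_one₀ hη' hδ.le hδ'.le) hβ.le hβ'.le
  have hE67 : 67 ≤ E := by nlinarith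
  have h1 : Real.exp (-(η * k / 4)) ≤ E⁻¹ := by
    rw [hE, ← Real.exp_neg]
    refine Real.exp_le_exp.2 (neg_le_neg ?_)
    have : 0 ≤ η * k := by positivity
    rw [ht]
    nlinarith
  have hu : Real.exp e ≤ 1 + 2 * e := by
    refine (Real.exp_bound_div_one_sub_of_interval he.le (by linarith)).trans ?_
    rw [div_le_iff₀ (by linarith)]
    nlinarith
  have hu1 : 1 ≤ Real.exp e := Real.one_le_exp he.le
  have h2 : (1 + (Real.exp e - 1) * (η / 32)) ^ k ≤ Real.exp (t / 2) := by
    calc (1 + (Real.exp e - 1) * (η / 32)) ^ k ≤ Real.exp (2 * e * (η / 32)) ^ k := by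
          refine pow_le_pow_left₀ (add_nonneg zero_le_one
            (mul_nonneg (by linarith) (by positivity))) ?_ k
          have := Real.add_one_le_exp (2 * e * (η / 32))
          nlinarith
      _ = _ := by
          rw [← Real.exp_nat_mul]
          congr 1
          rw [ht]
          ring
  have h3 : e * k ≤ 16 / η * Real.exp (t / 2) := by
    have h4 : t / 2 ≤ Real.exp (t / 2) := by linarith [Real.add_one_le_exp (t / 2)]
    have h5 : e * k = 16 / η * (t / 2) := by
      rw [ht]
      field_simp
      ring
    rw [h5]
    gcongr
  have h6 : e * (k * (L * (Real.exp e * (1 + (Real.exp e - 1) * (η / 32)) ^ k))) ≤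
      32 * L / η * E := by
    calc _ = (e * k) * (L * (Real.exp e * (1 + (Real.exp e - 1) * (η / 32)) ^ k)) := by ring
      _ ≤ (16 / η * Real.exp (t / 2)) * (L * (2 * Real.exp (t / 2))) := by
          gcongr
          linarith
      _ = 32 * L / η * (Real.exp (t / 2) * Real.exp (t / 2)) := by ring
      _ = _ := by
          rw [← Real.exp_add, add_halves]
  have h7 : Real.exp (e * (η * k / 4)) = E * E := by
    rw [hE, ← Real.exp_add]
    congr 1
    rw [ht]
    ring
  have h8 : (E * E - 1)⁻¹ ≤ 2 * (E⁻¹ * E⁻¹) := by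
    have : E * E / 2 ≤ E * E - 1 := by nlinarith
    calc (E * E - 1)⁻¹ ≤ (E * E / 2)⁻¹ := inv_anti₀ (by positivity) this
      _ = _ := by field_simp
  have h9 : 0 < E * E - 1 := by nlinarith
  rw [h7]
  calc _ ≤ E⁻¹ + (L / δ + 32 * L / η * E) * (2 * (E⁻¹ * E⁻¹)) := by
        gcongr
    _ = E⁻¹ * (1 + 2 * (L / δ) * E⁻¹ + 64 * L / η) := by
        field_simp
        ring
    _ ≤ E⁻¹ * (L / (η * δ) + 2 * (L / (η * δ)) * 1 + 64 * (L / (η * δ))) := by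
        have a1 : 1 ≤ L / (η * δ) := by
          rw [le_div_iff₀ (by positivity)]
          nlinarith
        have a2 : L / δ ≤ L / (η * δ) :=
          div_le_div_of_nonneg_left (by positivity) (by positivity) (by nlinarith)
        have a3 : L / η ≤ L / (η * δ) :=
          div_le_div_of_nonneg_left (by positivity) (by positivity) (by nlinarith)
        have a4 : E⁻¹ ≤ 1 := inv_le_one_of_one_le₀ (by linarith)
        have a5 : 64 * L / η ≤ 64 * (L / (η * δ)) := by
          rw [mul_div_assoc]
          linarith
        gcongr
    _ = 67 * L / (η * δ * E) := by
        field_simp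
        ring
    _ ≤ β := by
        rw [div_le_iff₀ (by positivity)]
        exact hE2

universe u

/-- The theorem for samples drawn from a countable discrete space `Z` of encoded examples, which
involves no measurability of hypotheses. -/
theorem exists_private_learner (K : ℕ) [NeZero K] (d : ℕ) :
    ∃ C : ℝ, 0 < C ∧ ∀ (X : Type u) (H : Set (X → Fin K)), ¬ ShattersDepth H (d + 1) →
      ∀ ε δ α β : ℝ, 0 < ε → ε < 1 → 0 < δ → δ < 1 → 0 < α → α < 1 / 2 → 0 < β → β < 1 / 2 →
      ∀ n : ℕ, C * (Real.log (1 / (β * δ)) / (α * ε)) ≤ (n : ℝ) →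
      ∃ A : RandomizedLearner X K n, IsDifferentiallyPrivate ε δ A ∧
        ∀ (Z : Type u) [MeasurableSpace Z] [Countable Z] [DiscreteMeasurableSpace Z]
          (P : Measure Z) [IsProbabilityMeasure P] (v : Z → X × Fin K), ∀ hs ∈ H,
          (∀ᵐ z ∂P, hs (v z).1 = (v z).2) →
          ENNReal.ofReal (1 - β) ≤ ∫⁻ S, (A (v ∘ S)).toOuterMeasure
            {f | P {z | f (v z).1 ≠ (v z).2} ≤ ENNReal.ofReal α}
            ∂(Measure.pi fun _ : Fin n => P) := by
  obtain ⟨η, hη, hη', hηp⟩ : ∃ η : ℝ, 0 < η ∧ η ≤ 1 ∧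
      ENNReal.ofReal η ≤ tournamentProb K (d + 1) / 2 := by
    have h1 : tournamentProb K (d + 1) / 2 ≤ 1 :=
      ENNReal.half_le_self.trans (tournamentProb_le_one NeZero.one_le _)
    have h0 : tournamentProb K (d + 1) / 2 ≠ 0 := by simp [tournamentProb_ne_zero]
    have ht : tournamentProb K (d + 1) / 2 ≠ ⊤ := ne_top_of_le_ne_top ENNReal.one_ne_top h1
    refine ⟨(tournamentProb K (d + 1) / 2).toReal, ENNReal.toReal_pos h0 ht, ?_, ?_⟩
    · simpa using ENNReal.toReal_mono ENNReal.one_ne_top h1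
    · rw [ENNReal.ofReal_toReal ht]
  set L : ℕ := Fintype.card (TournamentAdvice K (d + 1)) with hLdef
  have hL : (1 : ℝ) ≤ L := by
    obtain ⟨a⟩ : Nonempty (TournamentAdvice K (d + 1)) := by
      have : ∀ k, Nonempty (TournamentAdvice K k) := fun k => by
        induction k with
        | zero => exact ⟨()⟩
        | succ k ih => exact ⟨(ih.some, none)⟩
      exact this _
    exact_mod_cast Fintype.card_pos_iff.2 ⟨a⟩
  -- `m = ⌈b / α⌉` fresh examples per block and `k ≥ c₁ log (1 / (β δ)) / ε` blocks will do.
  set b : ℝ := Real.log (32 / η) with hb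
  have hb0 : 0 < b := Real.log_pos (by rw [lt_div_iff₀ hη]; linarith)
  set a₀ : ℝ := Real.log (67 * L / η) with ha₀
  have ha₀0 : 0 ≤ a₀ := Real.log_nonneg (by rw [le_div_iff₀ hη]; linarith)
  set c₁ : ℝ := 24 / η * (1 + 2 * a₀) with hc₁
  have hc₁0 : 0 < c₁ := by positivity
  set c₃ : ℝ := 2 ^ (d + 2) * (b + 1) with hc₃
  have hc₃0 : 0 < c₃ := by positivity
  refine ⟨c₃ * (c₁ + 2), by positivity, ?_⟩
  intro X H hH ε δ α β hε hε' hδ hδ' hα hα' hβ hβ' n hn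
  set ℓ : ℝ := Real.log (1 / (β * δ)) with hℓ
  have hℓ0 : 1 / 2 ≤ ℓ := by
    have h1 : Real.log 2 ≤ ℓ := by
      refine Real.log_le_log (by norm_num) ?_
      rw [le_div_iff₀ (by positivity)]
      nlinarith
    linarith [Real.log_two_gt_d9]
  set m : ℕ := ⌈b / α⌉₊ with hm
  have hm0 : 0 < m := Nat.ceil_pos.2 (by positivity)
  have hmle : (m : ℝ) ≤ (b + 1) / α := by
    refine (Nat.ceil_lt_add_one (by positivity)).le.trans ?_
    rw [add_div]
    gcongr
    rw [le_div_iff₀ hα]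
    linarith
  have hq : (1 - α) ^ m ≤ η / 32 := by
    calc (1 - α) ^ m ≤ Real.exp (-α) ^ m :=
          pow_le_pow_left₀ (by linarith) (by linarith [Real.add_one_le_exp (-α)]) m
      _ = Real.exp (-(m * α)) := by
          rw [← Real.exp_nat_mul]
          ring_nf
      _ ≤ Real.exp (-b) := by
          refine Real.exp_le_exp.2 (neg_le_neg ?_)
          have := Nat.le_ceil (b / α)
          rwa [div_le_iff₀ hα] at this
      _ = η / 32 := by
          rw [hb, Real.exp_neg, Real.exp_log (by positivity), inv_div]
  set N : ℕ := Fintype.card (TournamentIdx m (d + 1) ⊕ Fin m) with hN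
  have hN0 : 0 < N := Fintype.card_pos_iff.2 ⟨Sum.inr ⟨0, hm0⟩⟩
  have hNle : (N : ℝ) ≤ c₃ / α := by
    have h1 : N ≤ 2 ^ (d + 2) * m := by
      rw [hN, TournamentIdx.card]
      exact Nat.mul_le_mul_right _ (Nat.sub_le _ _)
    calc (N : ℝ) ≤ 2 ^ (d + 2) * m := by exact_mod_cast h1
      _ ≤ 2 ^ (d + 2) * ((b + 1) / α) := by gcongr
      _ = _ := by rw [hc₃, mul_div_assoc]
  set k : ℕ := n / N with hk
  have hkge : c₁ * ℓ / ε ≤ k := by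
    have h1 : (n : ℝ) < N * (k + 1) := by
      have := Nat.lt_mul_div_succ n hN0
      exact_mod_cast this
    have h2 : c₃ / α * ((c₁ + 2) * ℓ / ε) ≤ c₃ / α * (k + 1) := by
      calc c₃ / α * ((c₁ + 2) * ℓ / ε) = c₃ * (c₁ + 2) * (ℓ / (α * ε)) := by
            field_simp
        _ ≤ n := hn
        _ ≤ N * (k + 1) := h1.le
        _ ≤ c₃ / α * (k + 1) := by gcongr
    have h3 := le_of_mul_le_mul_left h2 (by positivity)
    have h4 : 1 ≤ 2 * ℓ / ε := by
      rw [le_div_iff₀ hε]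
      linarith
    have h5 : (c₁ + 2) * ℓ / ε = c₁ * ℓ / ε + 2 * ℓ / ε := by ring
    linarith
  have hlog : Real.log (67 * L / (η * δ * β)) ≤ ε / 3 * η * k / 8 := by
    have h1 : Real.log (67 * L / (η * δ * β)) = a₀ + ℓ := by
      rw [ha₀, hℓ, ← Real.log_mul (by positivity) (by positivity)]
      congr 1
      field_simp
    rw [h1]
    calc a₀ + ℓ ≤ (1 + 2 * a₀) * ℓ := by nlinarith
      _ = ε * η / 24 * (c₁ * ℓ / ε) := by
          rw [hc₁]
          field_simp
      _ ≤ ε * η / 24 * k := by gcongr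
      _ = _ := by ring
  obtain ⟨e⟩ : Nonempty (Fin k × (TournamentIdx m (d + 1) ⊕ Fin m) ↪ Fin n) := by
    refine Function.Embedding.nonempty_of_card_le ?_
    rw [Fintype.card_prod, Fintype.card_fin, Fintype.card_fin]
    exact Nat.div_mul_le_self n N
  have hM : 0 < (L : ℝ) / δ := by positivity
  refine ⟨votingLearner H (ε / 3) hM e,
    isDifferentiallyPrivate_votingLearner hε hε' hδ hδ' hM e.injective, ?_⟩
  intro Z _ _ _ P _ v hs hsH hv
  have hfail : ∫⁻ S, (votingLearner H (ε / 3) hM e (v ∘ S)).toOuterMeasure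
      {f | P {z | f (v z).1 ≠ (v z).2} ≤ ENNReal.ofReal α}ᶜ ∂(Measure.pi fun _ : Fin n => P) ≤
      ENNReal.ofReal β := by
    refine (lintegral_votingLearner_bad_le hH hsH hv (by positivity) hM (by linarith) hq hηp
      e.injective).trans (le_trans (le_of_eq ?_) (ENNReal.ofReal_le_ofReal (failure_bound_le
        (L := L) hη hη' hL (by positivity : 0 < ε / 3) (by linarith) hδ hδ' hβ hlog
        (by linarith))))
    have hu1 : 1 < Real.exp (ε / 3) := Real.one_lt_exp_iff.2 (by positivity)
    have hu0 : 0 ≤ Real.exp (ε / 3) - 1 := by linarith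
    have hk0 : 0 < (k : ℝ) := lt_of_lt_of_le (by positivity) hkge
    have hD : 0 < Real.exp (ε / 3 * (η * k / 4)) - 1 := by
      have : 1 < Real.exp (ε / 3 * (η * k / 4)) := Real.one_lt_exp_iff.2 (by positivity)
      linarith
    rw [ENNReal.ofReal_add (by positivity) (by positivity), ENNReal.ofReal_mul (by positivity),
      ENNReal.ofReal_add (by positivity) (by positivity), ENNReal.ofReal_inv_of_pos hD,
      ENNReal.ofReal_mul (p := ε / 3) (by positivity),
      ENNReal.ofReal_mul (p := (k : ℝ)) (by positivity),
      ENNReal.ofReal_mul (p := (L : ℝ)) (by positivity),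
      ENNReal.ofReal_mul (p := Real.exp (ε / 3)) (by positivity),
      ENNReal.ofReal_pow (by positivity), ENNReal.ofReal_add (by positivity) (by positivity),
      ENNReal.ofReal_mul hu0, ENNReal.ofReal_sub (Real.exp (ε / 3)) zero_le_one, ENNReal.ofReal_one,
      ENNReal.ofReal_natCast, ENNReal.ofReal_natCast]
  rw [ENNReal.ofReal_sub _ hβ.le, ENNReal.ofReal_one, tsub_le_iff_right]
  refine le_trans ?_ (add_le_add_right hfail _)
  rw [← lintegral_add_left (measurable_of_countable _)]
  calc (1 : ENNReal) = ∫⁻ _, 1 ∂(Measure.pi fun _ : Fin n => P) := by simp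
    _ ≤ _ := by
      refine lintegral_mono fun S => ?_
      refine le_trans ?_ (measure_union_le _ _)
      rw [Set.union_compl_self, PMF.toOuterMeasure_apply, Set.indicator_univ, PMF.tsum_coe]

/-! ### Reduction to countably many instances -/

/-- Over a pointwise separable class of finite Littlestone dimension, the distribution of the examples
lives on countably many classes of instances that all hypotheses treat alike. -/
theorem exists_countable_coding {X Q : Type*} [MeasurableSpace X] {K n : ℕ} [NeZero K]
    {H : Set (X → Fin K)} (hH : ¬ ShattersDepth H n) {D : Measure (X × Fin K)}
    [IsProbabilityMeasure D] (hD : PointwiseSeparable H D) {q : X → Q}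
    (hq : ∀ x x', q x = q x' ↔ ∀ h ∈ H, h x = h x') :
    ∃ C : Set Q, C.Countable ∧ ∃ φ : X → C, (∀ c, MeasurableSet (φ ⁻¹' {c})) ∧
      ∀ᵐ z ∂D, (φ z.1 : Q) = q z.1 := by
  classical
  obtain ⟨X₀, hX₀, hnull, hmeas, H₀, hH₀, hc, hlim⟩ := hD
  have hae : ∀ᵐ z ∂D, z.1 ∈ X₀ := hnull
  -- On `X₀`, agreement of the hypotheses of the countable subclass is agreement of all hypotheses.
  have hsep : ∀ x ∈ X₀, ∀ x' ∈ X₀, (∀ h ∈ H₀, h x = h x') → q x = q x' := by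
    intro x hx x' hx' hxx
    refine (hq x x').2 fun h hh => ?_
    obtain ⟨u, hu, hux⟩ := hlim h hh
    obtain ⟨i, hi, hi'⟩ := ((hux x hx).and (hux x' hx')).exists
    rw [← hi, ← hi', hxx _ (hu i)]
  have hfib : ∀ x₁ ∈ X₀, MeasurableSet {x | x ∈ X₀ ∧ q x = q x₁} := by
    intro x₁ hx₁
    have : {x | x ∈ X₀ ∧ q x = q x₁} =
        X₀ ∩ ⋂ h ∈ H₀, Subtype.val '' {x : X₀ | h x = h x₁} ∪ X₀ᶜ := by
      ext x
      simp only [Set.mem_inter_iff, Set.mem_iInter, Set.mem_union, Set.mem_compl_iff]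
      refine and_congr_right fun hx => ⟨fun hqx h hh => Or.inl ⟨⟨x, hx⟩, ?_, rfl⟩, fun hall => ?_⟩
      · exact (hq x x₁).1 hqx h (hH₀ hh)
      · refine hsep x hx x₁ hx₁ fun h hh => ?_
        obtain ⟨z, hz, rfl⟩ := (hall h hh).resolve_right (not_not.2 hx)
        exact hz
    rw [this]
    refine hX₀.inter (MeasurableSet.biInter hc fun h hh => MeasurableSet.union ?_ hX₀.compl)
    exact hX₀.subtype_image (hmeas h (hH₀ hh) (measurableSet_singleton _))
  have hcount : (q '' X₀).Countable := by
    have hr := countable_types_of_not_shattersDepth hc (fun hs => hH (hs.mono hH₀)) X₀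
    refine Set.countable_of_injective_of_countable_image
      (f := fun c (h : H₀) => if hc : c ∈ q '' X₀ then h.1 hc.choose else 0) ?_ (hr.mono ?_)
    · intro c hc c' hc' he
      simp only [dif_pos hc, dif_pos hc'] at he
      rw [← hc.choose_spec.2, ← hc'.choose_spec.2]
      exact hsep _ hc.choose_spec.1 _ hc'.choose_spec.1 fun h hh => congrFun he ⟨h, hh⟩
    · rintro _ ⟨c, hc, rfl⟩
      exact ⟨hc.choose, hc.choose_spec.1, by simp only [dif_pos hc]⟩
  obtain ⟨z₀, hz₀⟩ := hae.exists
  refine ⟨q '' X₀, hcount,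
    fun x => if hx : x ∈ X₀ then ⟨q x, x, hx, rfl⟩ else ⟨q z₀.1, z₀.1, hz₀, rfl⟩, ?_, ?_⟩
  · rintro ⟨_, x₁, hx₁, rfl⟩
    have : (fun x => if hx : x ∈ X₀ then (⟨q x, x, hx, rfl⟩ : q '' X₀)
        else ⟨q z₀.1, z₀.1, hz₀, rfl⟩) ⁻¹' {⟨q x₁, x₁, hx₁, rfl⟩} =
        {x | x ∈ X₀ ∧ q x = q x₁} ∪ if q z₀.1 = q x₁ then X₀ᶜ else ∅ := by
      ext x
      by_cases hx : x ∈ X₀ <;> by_cases hz : q z₀.1 = q x₁ <;> simp [hx, hz, Subtype.ext_iff]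
    rw [this]
    refine (hfib x₁ hx₁).union ?_
    split_ifs
    · exact hX₀.compl
    · exact MeasurableSet.empty
  · filter_upwards [hae] with z hz
    simp [hz]

/-- Privacy survives precomposition with a map of the instances. -/
theorem IsDifferentiallyPrivate.comp {X Q : Type*} {K n : ℕ} {ε δ : ℝ} (hε : 0 ≤ ε)
    {A : RandomizedLearner Q K n} (hA : IsDifferentiallyPrivate ε δ A) (q : X → Q) :
    IsDifferentiallyPrivate ε δ (fun S : Fin n → X × Fin K =>
      (A fun i => (q (S i).1, (S i).2)).map fun g => g ∘ q) := by
  rintro S S' ⟨i, -, hi⟩ T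
  simp only [PMF.toOuterMeasure_map_apply]
  by_cases he : (q (S i).1, (S i).2) = (q (S' i).1, (S' i).2)
  · have : (fun i => (q (S i).1, (S i).2)) = fun i => (q (S' i).1, (S' i).2) := by
      funext j
      by_cases hj : j = i
      · rw [hj, he]
      · rw [hi j hj]
    rw [this]
    exact le_add_right (le_mul_of_one_le_left zero_le
      (ENNReal.one_le_ofReal.2 (Real.one_le_exp hε)))
  · exact hA _ _ ⟨i, he, fun j hj => by rw [hi j hj]⟩ _

theorem mainTheorem2 (K : ℕ) (hK : 2 ≤ K) (d : ℕ) :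
    ∃ C : ℝ, 0 < C ∧
      ∀ (X : Type*) [MeasurableSpace X] (H : Set (X → Fin K)), Ldim H = (d : ℕ∞) →
      ∀ ε δ α β : ℝ, 0 < ε → ε < 1 → 0 < δ → δ < 1 → 0 < α → α < 1 / 2 → 0 < β → β < 1 / 2 →
      ∀ n : ℕ, C * (Real.log (1 / (β * δ)) / (α * ε)) ≤ (n : ℝ) →
      ∃ A : RandomizedLearner X K n,
        IsDifferentiallyPrivate ε δ A ∧
        ∀ D : Measure (X × Fin K), IsProbabilityMeasure D → Realizable H D →
          PointwiseSeparable H D →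
          ENNReal.ofReal (1 - β) ≤ successProb A D α := by
  have : NeZero K := ⟨by omega⟩
  obtain ⟨C, hC, hmain⟩ := exists_private_learner K d
  refine ⟨C, hC, fun X _ H hLdim ε δ α β hε hε' hδ hδ' hα hα' hβ hβ' n hn => ?_⟩
  have hH := not_shattersDepth_of_ldim_eq hLdim
  -- The learner works on the quotient of `X` that identifies instances on which `H` agrees.
  let s : Setoid X := Setoid.ker fun (x : X) (h : H) => h.1 x
  let q : X → Quotient s := Quotient.mk s
  have hq : ∀ x x', q x = q x' ↔ ∀ h ∈ H, h x = h x' := fun x x' =>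
    Quotient.eq.trans ⟨fun h f hf => congrFun h ⟨f, hf⟩, fun h => funext fun f => h f f.2⟩
  let H' : Set (Quotient s → Fin K) := {g | g ∘ q ∈ H}
  have hH' : ¬ ShattersDepth H' (d + 1) := fun hs =>
    hH ((hs.comp_surjective Quotient.mk_surjective).mono (by rintro _ ⟨g, hg, rfl⟩; exact hg))
  obtain ⟨A, hA, hsucc⟩ := hmain _ H' hH' ε δ α β hε hε' hδ hδ' hα hα' hβ hβ' n hn
  refine ⟨_, hA.comp hε.le q, fun D hDp ⟨h, hh, hloss⟩ hsep => ?_⟩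
  obtain ⟨C', hC', φ, hφ, hφq⟩ := exists_countable_coding hH hsep hq
  have : Countable C' := hC'
  let _ : MeasurableSpace C' := ⊤
  let Φ (z : X × Fin K) : C' × Fin K := (φ z.1, z.2)
  have hΦ : Measurable Φ :=
    ((measurable_to_countable' hφ).comp measurable_fst).prodMk measurable_snd
  let v (z : C' × Fin K) : Quotient s × Fin K := (z.1, z.2)
  have : IsProbabilityMeasure (D.map Φ) := Measure.isProbabilityMeasure_map hΦ.aemeasurable
  have hvΦ : ∀ᵐ z ∂D, v (Φ z) = (q z.1, z.2) := by
    filter_upwards [hφq] with z hz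
    exact Prod.ext hz rfl
  have hpop (g : Quotient s → Fin K) :
      D.map Φ {z | g (v z).1 ≠ (v z).2} = popLoss D (g ∘ q) := by
    rw [Measure.map_apply hΦ MeasurableSet.of_discrete, popLoss]
    refine measure_congr ?_
    filter_upwards [hvΦ] with z hz
    change (g (v (Φ z)).1 ≠ (v (Φ z)).2) = (g (q z.1) ≠ z.2)
    rw [hz]
  let h' : Quotient s → Fin K := Quotient.lift h fun x x' hx => (hq x x').1 (Quotient.sound hx) h hh
  have hh' : h' ∘ q = h := rfl
  have hreal : ∀ᵐ z ∂(D.map Φ), h' (v z).1 = (v z).2 := by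
    change D.map Φ {z | ¬ h' (v z).1 = (v z).2} = 0
    rw [← hloss]
    exact hpop h'
  refine (hsucc (C' × Fin K) (D.map Φ) v h' hh hreal).trans (le_of_eq ?_)
  have hmp := measurePreserving_pi (fun _ : Fin n => D) (fun _ => D.map Φ)
    (f := fun _ => Φ) fun _ => hΦ.measurePreserving D
  rw [← hmp.lintegral_comp (measurable_of_countable _), successProb]
  refine lintegral_congr_ae ?_
  have hall : ∀ᵐ S ∂(Measure.pi fun _ : Fin n => D), ∀ i, v (Φ (S i)) = (q (S i).1, (S i).2) :=
    eventually_all.2 fun i =>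
      (measurePreserving_eval (fun _ : Fin n => D) i).quasiMeasurePreserving.ae hvΦ
  filter_upwards [hall] with S hS
  rw [PMF.toOuterMeasure_map_apply]
  simp only [hpop]
  congr 2
  exact congrArg A (funext hS)
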